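/- **Lemma 6.6.** Let $F$ be a non-Archimedean local field with ring of integers $\mathcal{O}$, maximal ideal $\wp$ and finite residue field $\mathcal{O}/\wp$ of cardinality $q$. For $\ell\ge 1$ put $\mathcal{O}_\ell=\mathcal{O}/\wp^\ell$, and put $$G_{(2,1,1)}=\mathrm{Aut}_{\mathcal{O}}(\mathcal{O}_2\oplus\mathcal{O}_1\oplus\mathcal{O}_1),\qquad G_{(1,1)}=\mathrm{Aut}_{\mathcal{O}}(\mathcal{O}_1\oplus\mathcal{O}_1)\cong \mathrm{GL}_2(\mathcal{O}_1).$$ For a finite group $G$ let $\mathrm{Irr}(G)$ be the (finite) set of isomorphism classes of irreducible complex representations of $G$, and let $\mathcal{R}_G(\mathcal{D})=\sum_{\rho\in\mathrm{Irr}(G)}\mathcal{D}^{\dim\rho}\in\mathbb{Z}[\mathcal{D}]$ be its representation zeta function. Let $(\mathcal{O}_1^2\times\mathcal{O}_1^2)\rtimes G_{(1,1)}$ be the semidirect product in which an element of $G_{(1,1)}$ with matrix $D\in\mathrm{GL}_2(\mathcal{O}_1)$ acts on pairs of a row vector $v$ and a column vector $w$ by $(v,w)\mapsto(vD^{-1},Dw)$.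 Then $$\mathcal{R}_{G_{(2,1,1)}}(\mathcal{D})=(q-1)^2\,\mathcal{R}_{\mathrm{GL}_2(\mathcal{O}_1)}(\mathcal{D}^{q^2})+(q-1)\,\mathcal{R}_{(\mathcal{O}_1^2\times\mathcal{O}_1^2)\rtimes G_{(1,1)}}(\mathcal{D}),$$ where $$\mathcal{R}_{(\mathcal{O}_1^2\times\mathcal{O}_1^2)\rtimes G_{(1,1)}}(\mathcal{D})=\mathcal{R}_{G_{(1,1)}}(\mathcal{D})+2(q-1)\,\mathcal{D}^{q^2-1}+(q-1)^2\,\mathcal{D}^{(q^2-1)q}+(q+2)\,\mathcal{D}^{(q^2-1)(q-1)}.$$ -/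

import Mathlib

open scoped Polynomial ValuativeRel

noncomputable section

namespace RepZeta

/-! ### Complex irreducible representations and the representation zeta function -/

section Zeta

variable (G : Type*) [Group G]

/-- The irreducible complex matrix representations of `G` of finite dimension. Every irreducible
complex representation of a finite group is finite-dimensional, hence isomorphic to one on
some `ℂⁿ`. -/
def IrrRep : Type _ :=
  Σ n : ℕ, {ρ : Representation ℂ G (Fin n → ℂ) // ρ.IsIrreducible}

/-- Isomorphism of irreducible representations. -/
instance irrSetoid : Setoid (IrrRep G) where
  r ρ σ := Nonempty (Representation.Equiv ρ.2.1 σ.2.1)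
  iseqv :=
    { refl := fun ρ => ⟨Representation.Equiv.refl ρ.2.1⟩
      symm := fun ⟨e⟩ => ⟨e.symm⟩
      trans := fun ⟨e⟩ ⟨f⟩ => ⟨e.trans f⟩ }

/-- `Irr G`: the set of isomorphism classes of irreducible complex representations of `G`
(for a finite group `G`). -/
def Irr : Type _ := Quotient (irrSetoid G)

variable {G} in
/-- The dimension of an isomorphism class of irreducible representations. -/
def Irr.dim : Irr G → ℕ :=
  Quotient.lift (fun ρ : IrrRep G => ρ.1) (by
    rintro ⟨m, ρ⟩ ⟨n, σ⟩ ⟨e⟩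
    simpa using e.toLinearEquiv.finrank_eq)

/-- The representation zeta function `R_G(D) = ∑_{ρ ∈ Irr G} D ^ (dim ρ) ∈ ℤ[D]`
of a finite group `G`. -/
def zeta : ℤ[X] := ∑ᶠ ρ : Irr G, (Polynomial.X : ℤ[X]) ^ ρ.dim

end Zeta

/-! ### The finite modules `M_λ` and their automorphism groups -/

section Modules

variable (O : Type*) [CommRing O] [IsLocalRing O]

/-- `O_ℓ = O / ℘ ^ ℓ`, where `℘` is the maximal ideal of `O`. -/
abbrev Quo (l : ℕ) : Type _ := O ⧸ IsLocalRing.maximalIdeal O ^ l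

/-- `M_λ = O_{λ₁} ⊕ ⋯ ⊕ O_{λ_k}`. -/
abbrev M {k : ℕ} (lam : Fin k → ℕ) : Type _ := (i : Fin k) → Quo O (lam i)

/-- `G_λ = Aut_O(M_λ)`, the group of `O`-linear automorphisms of `M_λ`. -/
abbrev AutM {k : ℕ} (lam : Fin k → ℕ) : Type _ := M O lam ≃ₗ[O] M O lam

/-- The partition `(2, 1, 1)`. -/
abbrev lam211 : Fin 3 → ℕ := ![2, 1, 1]

/-- The partition `(1, 1)`. -/
abbrev lam11 : Fin 2 → ℕ := fun _ => 1

/-- The matrix `D ∈ GL₂(O₁)` of an automorphism of `M_{(1,1)} = O₁ ⊕ O₁`: the `j`-th column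
of `D` is the image of the `j`-th standard basis vector (see `matG11_mulVec`). -/
def matG11 : AutM O lam11 →* GL (Fin 2) (Quo O 1) where
  toFun g := Matrix.GeneralLinearGroup.toLin.symm
    ((LinearMap.GeneralLinearGroup.generalLinearEquiv (Quo O 1) (Fin 2 → Quo O 1)).symm
      (g.extendScalarsOfSurjective Ideal.Quotient.mk_surjective))
  map_one' := by
    rw [← map_one Matrix.GeneralLinearGroup.toLin.symm,
      ← map_one (LinearMap.GeneralLinearGroup.generalLinearEquiv (Quo O 1)
        (Fin 2 → Quo O 1)).symm]
    rfl
  map_mul' g h := by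
    rw [← map_mul, ← map_mul]
    rfl

theorem matG11_mulVec (g : AutM O lam11) (w : Fin 2 → Quo O 1) :
    Matrix.mulVec (matG11 O g).1 w = g w := by
  change Matrix.mulVec (LinearMap.toMatrix' _) w = _
  rw [LinearMap.toMatrix'_mulVec]
  rfl

/-- `(v, w) ↦ (v D⁻¹, D w)`, where `v` is a row vector and `w` is a column vector. -/
def vwEquiv {R : Type*} [CommRing R] (D : GL (Fin 2) R) :
    ((Fin 2 → R) × (Fin 2 → R)) ≃+ ((Fin 2 → R) × (Fin 2 → R)) where
  toFun x := (Matrix.vecMul x.1 (D⁻¹ : GL (Fin 2) R).1, Matrix.mulVec D.1 x.2)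
  invFun x := (Matrix.vecMul x.1 D.1, Matrix.mulVec (D⁻¹ : GL (Fin 2) R).1 x.2)
  left_inv x := by
    ext1 <;> simp only [Matrix.vecMul_vecMul, Matrix.mulVec_mulVec, Units.inv_mul,
      Matrix.vecMul_one, Matrix.one_mulVec]
  right_inv x := by
    ext1 <;> simp only [Matrix.vecMul_vecMul, Matrix.mulVec_mulVec, Units.mul_inv,
      Matrix.vecMul_one, Matrix.one_mulVec]
  map_add' x y := by
    ext1 <;> simp only [Prod.fst_add, Prod.snd_add, Matrix.add_vecMul, Matrix.mulVec_add]

/-- The action of `G_{(1,1)}` on `O₁² × O₁²` (an additive group, written multiplicatively):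
`(v, w) ↦ (v D⁻¹, D w)`, where `D ∈ GL₂(O₁)` is the matrix of the given element. -/
def vwAction : AutM O lam11 →* MulAut (Multiplicative ((Fin 2 → Quo O 1) × (Fin 2 → Quo O 1))) where
  toFun g := AddEquiv.toMultiplicative (vwEquiv (matG11 O g))
  map_one' := by
    ext x <;> simp [vwEquiv]
  map_mul' g h := by
    refine MulEquiv.ext fun x => ?_
    change Multiplicative.ofAdd (vwEquiv (matG11 O (g * h)) x.toAdd) =
      Multiplicative.ofAdd (vwEquiv (matG11 O g) (vwEquiv (matG11 O h) x.toAdd))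
    congr 1
    simp only [vwEquiv, AddEquiv.coe_mk, Equiv.coe_fn_mk, map_mul, mul_inv_rev, Units.val_mul,
      Matrix.vecMul_vecMul, Matrix.mulVec_mulVec]

/-- The group `(O₁² × O₁²) ⋊ G_{(1,1)}`. -/
abbrev SemiG11 : Type _ :=
  Multiplicative ((Fin 2 → Quo O 1) × (Fin 2 → Quo O 1)) ⋊[vwAction O] AutM O lam11

end Modules

end RepZeta

end

/-! Write R for O₂, K for O₁ and π : K → R for multiplication by a uniformizer. Automorphisms of R ⊕
K² are block matrices (a, b; c, D) with a ∈ Rˣ, D ∈ GL₂(K) and b, c ∈ K², where the product of a row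
and a column enters the corner through π. The only tool is Clifford theory,
`Stabilizer.zetaOn_hasWeight`: if a linear character χ of a normal subgroup A extends to its
stabilizer S, then coinducing the twisted inflations of Irr(S/A) gives exactly the irreducibles over
χ, and dimensions get multiplied by [G : S].

The scalars Rˣ are central, so each irreducible has one central character ω, out of q(q-1). For the
q-1 characters trivial on 1 + πK, ω extends to G through the corner a mod π, and G modulo scalars is
(K² × K²) ⋊ GL₂(K) by g ↦ (bD⁻¹, a⁻¹c, a⁻¹D) (`zetaOn_scalars_of_trivial`). For the other (q-1)² the
abelian normal subgroup of matrices (u, uβ; 0, u) is used: conjugation multiplies u by 1 - π(βD⁻¹c),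
so all extensions of ω to it are conjugate (`hasWeight_borel_iff`). The stabilizer of the extension
trivial in β is {c = 0}, of index q², with quotient GL₂(K) (`zetaOn_borel`). `zeta_eq` adds up the
two kinds.

For the semidirect product, characters of K² × K² are pairs of a column x and a row ξ. Apart from
(0, 0), the GL₂(K)-orbits are x ≠ 0 = ξ; x = 0 ≠ ξ; both nonzero with ξx = 0; and ξx = c for each c
∈ Kˣ. The stabilizers are two groups K ⋊ Kˣ, one K, and one Kˣ for each c; their zeta functions are
elementary and `zeta_vw` collects them. -/

noncomputable section

namespace RepZeta

/-! ### Irreducibles, their isomorphism classes, and pieces of the zeta function. -/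

section Basic

variable {G : Type*} [Group G]

theorem isIrreducible_iff {V : Type*} [AddCommGroup V] [Module ℂ V] (ρ : Representation ℂ G V) :
    ρ.IsIrreducible ↔ Nontrivial V ∧
      ∀ W : Submodule ℂ V, (∀ g, ∀ w ∈ W, ρ g w ∈ W) → W = ⊥ ∨ W = ⊤ := by
  constructor
  · intro h
    refine ⟨?_, fun W hW => ?_⟩
    · by_contra hV
      rw [not_nontrivial_iff_subsingleton] at hV
      have := h.toNontrivial
      obtain ⟨x, y, hxy⟩ := this
      apply hxy
      apply SetLike.ext
      intro v
      rw [Subsingleton.elim v 0]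
      exact ⟨fun _ => y.toSubmodule.zero_mem, fun _ => x.toSubmodule.zero_mem⟩
    · rcases h.eq_bot_or_eq_top ⟨W, fun g v hv => hW g v hv⟩ with h | h
      · left
        exact congrArg Subrepresentation.toSubmodule h
      · right
        exact congrArg Subrepresentation.toSubmodule h
  · rintro ⟨hV, h⟩
    have : Nontrivial (Subrepresentation ρ) := by
      refine ⟨⊥, ⊤, fun hbt => ?_⟩
      have h' : (⊥ : Submodule ℂ V) = ⊤ := congrArg Subrepresentation.toSubmodule hbt
      exact bot_ne_top h'
    refine ⟨fun W => ?_⟩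
    rcases h W.toSubmodule (fun g w hw => W.apply_mem_toSubmodule g hw) with h | h
    · left
      exact Subrepresentation.toSubmodule_injective h
    · right
      exact Subrepresentation.toSubmodule_injective h

theorem equiv_apply_rep {V W : Type*} [AddCommGroup V] [Module ℂ V] [AddCommGroup W]
    [Module ℂ W] {ρ : Representation ℂ G V} {σ : Representation ℂ G W} (e : ρ.Equiv σ) (g : G)
    (v : V) : e (ρ g v) = σ g (e v) :=
  Representation.IntertwiningMap.isIntertwining _ _ e.toIntertwiningMap g v

theorem IsIrreducible.of_equiv {V W : Type*} [AddCommGroup V] [Module ℂ V] [AddCommGroup W]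
    [Module ℂ W] {ρ : Representation ℂ G V} {σ : Representation ℂ G W} (e : ρ.Equiv σ)
    (h : ρ.IsIrreducible) : σ.IsIrreducible := by
  rw [isIrreducible_iff] at h ⊢
  obtain ⟨hV, h⟩ := h
  refine ⟨e.toLinearEquiv.symm.toEquiv.nontrivial, fun U hU => ?_⟩
  rcases h (U.comap e.toLinearEquiv.toLinearMap) (fun g w hw => by
    change e (ρ g w) ∈ U
    rw [equiv_apply_rep]
    exact hU g _ hw) with h | h
  · left
    rw [eq_bot_iff]
    intro u hu
    have : e.toLinearEquiv.symm u ∈ U.comap e.toLinearEquiv.toLinearMap := by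
      change e.toLinearEquiv (e.toLinearEquiv.symm u) ∈ U
      rwa [LinearEquiv.apply_symm_apply]
    rw [h, Submodule.mem_bot] at this
    exact (LinearEquiv.map_eq_zero_iff _).1 this
  · right
    rw [eq_top_iff]
    intro u _
    have : e.toLinearEquiv.symm u ∈ U.comap e.toLinearEquiv.toLinearMap := by
      rw [h]; trivial
    change e.toLinearEquiv (e.toLinearEquiv.symm u) ∈ U at this
    rwa [LinearEquiv.apply_symm_apply] at this

/-- A chosen representation in an isomorphism class. -/
def Irr.rep (r : Irr G) : Representation ℂ G (Fin (Quotient.out r).1 → ℂ) :=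
  (Quotient.out r).2.1

theorem Irr.rep_irreducible (r : Irr G) : r.rep.IsIrreducible := (Quotient.out r).2.2

theorem Irr.dim_eq (r : Irr G) : r.dim = Module.finrank ℂ (Fin (Quotient.out r).1 → ℂ) := by
  conv_lhs => rw [← Quotient.out_eq r]
  rw [Module.finrank_fin_fun]
  rfl

theorem Irr.eq_of_equiv {r s : Irr G} (h : Nonempty (r.rep.Equiv s.rep)) : r = s := by
  rw [← Quotient.out_eq r, ← Quotient.out_eq s]
  exact Quotient.sound h

/-- The restriction of scalars along a linear equivalence of the underlying spaces. -/
theorem exists_equiv_of_linearEquiv {V W : Type*} [AddCommGroup V] [Module ℂ V] [AddCommGroup W]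
    [Module ℂ W] (ρ : Representation ℂ G V) (e : V ≃ₗ[ℂ] W) :
    ∃ σ : Representation ℂ G W, Nonempty (ρ.Equiv σ) := by
  refine ⟨(e.conjRingEquiv : Module.End ℂ V →* Module.End ℂ W).comp ρ,
    ⟨Representation.Equiv.mk e fun g => ?_⟩⟩
  ext v
  simp [LinearEquiv.conjRingEquiv]

theorem Irr.exists_equiv {V : Type*} [AddCommGroup V] [Module ℂ V] [FiniteDimensional ℂ V]
    (ρ : Representation ℂ G V) (h : ρ.IsIrreducible) :
    ∃ r : Irr G, Nonempty (ρ.Equiv r.rep) := by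
  obtain ⟨σ, ⟨e⟩⟩ := exists_equiv_of_linearEquiv ρ (Module.finBasis ℂ V).equivFun
  let x : IrrRep G := ⟨_, σ, IsIrreducible.of_equiv e h⟩
  obtain ⟨f⟩ : Nonempty (Representation.Equiv (Quotient.out (⟦x⟧ : Irr G)).2.1 σ) :=
    Quotient.exact (Quotient.out_eq (⟦x⟧ : Irr G))
  exact ⟨⟦x⟧, ⟨e.trans f.symm⟩⟩

theorem Irr.dim_eq_of_equiv {V : Type*} [AddCommGroup V] [Module ℂ V]
    {ρ : Representation ℂ G V} {r : Irr G} (e : ρ.Equiv r.rep) : r.dim = Module.finrank ℂ V := by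
  rw [r.dim_eq, e.toLinearEquiv.finrank_eq]

theorem equiv_of_intertwiningMap {V W : Type*} [AddCommGroup V] [Module ℂ V] [AddCommGroup W]
    [Module ℂ W] {ρ : Representation ℂ G V} {σ : Representation ℂ G W} (hρ : ρ.IsIrreducible)
    (hσ : σ.IsIrreducible) (f : V →ₗ[ℂ] W) (hf : ∀ g v, f (ρ g v) = σ g (f v)) (h0 : f ≠ 0) :
    Nonempty (ρ.Equiv σ) := by
  let F : ρ.IntertwiningMap σ := ⟨f, fun g => by ext v; exact hf g v⟩
  rcases Representation.IsIrreducible.bijective_or_eq_zero F with h | h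
  · exact ⟨F.ofBijective h⟩
  · exact absurd (congrArg Representation.IntertwiningMap.toLinearMap h) h0

/-- Orthonormality makes the irreducible characters linearly independent in the finite-dimensional
space of functions on `G`; `φ s` is the inner product with the character of `s`. -/
instance Irr.instFinite [Finite G] : Finite (Irr G) := by
  classical
  have := Fintype.ofFinite G
  have hG : (Nat.card G : ℂ) ≠ 0 := by exact_mod_cast Nat.card_pos.ne'
  have : Invertible (Nat.card G : ℂ) := invertibleOfNonzero hG
  let φ : Irr G → (G → ℂ) →ₗ[ℂ] ℂ := fun s =>
    (Nat.card G : ℂ)⁻¹ • ∑ g : G, s.rep.character g⁻¹ • LinearMap.proj g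
  have key : ∀ r s : Irr G, φ s r.rep.character =
      if Nonempty (s.rep.Equiv r.rep) then 1 else 0 := by
    intro r s
    have := r.rep_irreducible
    have := s.rep_irreducible
    rw [← Representation.char_orthonormal r.rep s.rep]
    simp [φ, mul_comm]
  have : LinearIndependent ℂ (fun r : Irr G => r.rep.character) := by
    refine LinearIndependent.of_pairwise_dual_eq_zero_one _ φ ?_ ?_
    · intro s r hsr
      rw [key, if_neg]
      exact fun h => hsr (Irr.eq_of_equiv h)
    · intro r
      rw [key, if_pos ⟨Representation.Equiv.refl _⟩]
  exact this.finite

/-- The part of the representation zeta function coming from a set of irreducible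
representations. -/
def zetaOn (s : Set (Irr G)) : ℤ[X] := ∑ᶠ (r : Irr G) (_ : r ∈ s), (Polynomial.X : ℤ[X]) ^ r.dim

theorem zeta_eq_sum_zetaOn [Finite G] {T : Type*} [Fintype T] (s : T → Set (Irr G))
    (h : ∀ r, ∃! t, r ∈ s t) : zeta G = ∑ t, zetaOn (s t) := by
  classical
  have := Fintype.ofFinite (Irr G)
  simp only [zeta, zetaOn, finsum_eq_sum_of_fintype]
  rw [Finset.sum_comm]
  refine Finset.sum_congr rfl fun r _ => ?_
  obtain ⟨t, ht, hu⟩ := h r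
  rw [Finset.sum_eq_single t]
  · simp [ht]
  · intro t' _ htt
    have : r ∉ s t' := fun h => htt (hu t' h)
    simp [this]
  · simp

theorem zetaOn_eq_of_bijOn [Finite G] {H : Type*} [Group H] [Finite H] (s : Set (Irr G)) (n : ℕ)
    (F : Irr H → Irr G) (hF : Function.Injective F) (hs : Set.range F = s)
    (hd : ∀ r, (F r).dim = n * r.dim) : zetaOn s = (zeta H).comp (Polynomial.X ^ n) := by
  have := Fintype.ofFinite (Irr H)
  rw [zetaOn, ← hs, finsum_mem_range hF, zeta, finsum_eq_sum_of_fintype, finsum_eq_sum_of_fintype,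
    ← Polynomial.coe_compRingHom_apply, map_sum]
  refine Finset.sum_congr rfl fun r _ => ?_
  rw [hd, Polynomial.coe_compRingHom_apply, Polynomial.X_pow_comp, pow_mul]

end Basic

/-! ### Linear characters of a subgroup occurring in a representation. -/

section Weights

variable {A G V : Type*} [Group A] [Group G] [AddCommGroup V] [Module ℂ V]

/-- The vectors on which `A`, mapped to `G` by `i`, acts through the linear character `χ`. -/
def weightSpace (i : A →* G) (χ : A →* ℂˣ) (ρ : Representation ℂ G V) : Submodule ℂ V where
  carrier := {v | ∀ a, ρ (i a) v = (χ a : ℂ) • v}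
  add_mem' hv hw a := by rw [map_add, hv a, hw a, smul_add]
  zero_mem' a := by rw [map_zero, smul_zero]
  smul_mem' c v hv a := by rw [map_smul, hv a, smul_comm]

/-- The character `χ` of `A` occurs in the restriction of `ρ` along `i`. -/
def HasWeight (i : A →* G) (χ : A →* ℂˣ) (ρ : Representation ℂ G V) : Prop :=
  ∃ v ≠ 0, v ∈ weightSpace i χ ρ

theorem HasWeight.of_equiv {W : Type*} [AddCommGroup W] [Module ℂ W] {i : A →* G} {χ : A →* ℂˣ}
    {ρ : Representation ℂ G V} {σ : Representation ℂ G W} (h : HasWeight i χ ρ) (e : ρ.Equiv σ) :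
    HasWeight i χ σ := by
  obtain ⟨v, hv, hw⟩ := h
  refine ⟨e.toLinearEquiv v, fun h => hv ((LinearEquiv.map_eq_zero_iff _).1 h), fun a => ?_⟩
  have := equiv_apply_rep e (i a) v
  rw [hw a] at this
  rw [← map_smul]
  exact this.symm

theorem rep_mem_weightSpace {i : A →* G} {χ χ' : A →* ℂˣ} {ρ : Representation ℂ G V} {g : G}
    (h : ∀ b, ∃ a, i b = g * i a * g⁻¹ ∧ χ' b = χ a) {v : V} (hv : v ∈ weightSpace i χ ρ) :
    ρ g v ∈ weightSpace i χ' ρ := by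
  intro b
  obtain ⟨a, hab, hχ⟩ := h b
  rw [hχ, ← map_smul, ← hv a, hab, ← Module.End.mul_apply, ← Module.End.mul_apply, ← map_mul,
    ← map_mul, inv_mul_cancel_right]

theorem rep_ne_zero (ρ : Representation ℂ G V) (g : G) {v : V} (hv : v ≠ 0) : ρ g v ≠ 0 := by
  intro h
  apply hv
  have := congrArg (ρ g⁻¹) h
  rwa [← Module.End.mul_apply, ← map_mul, inv_mul_cancel, map_one, Module.End.one_apply,
    map_zero] at this

theorem HasWeight.conj {i : A →* G} {χ χ' : A →* ℂˣ} {ρ : Representation ℂ G V} (g : G)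
    (h : ∀ b, ∃ a, i b = g * i a * g⁻¹ ∧ χ' b = χ a) (hχ : HasWeight i χ ρ) :
    HasWeight i χ' ρ := by
  obtain ⟨v, hv, hw⟩ := hχ
  exact ⟨ρ g v, rep_ne_zero ρ g hv, rep_mem_weightSpace h hw⟩

theorem span_orbit_eq_top {ρ : Representation ℂ G V} (h : ρ.IsIrreducible) {v : V} (hv : v ≠ 0) :
    Submodule.span ℂ (Set.range fun g => ρ g v) = ⊤ := by
  rw [isIrreducible_iff] at h
  refine (h.2 _ fun g w hw => ?_).resolve_left fun h0 => hv ?_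
  · induction hw using Submodule.span_induction with
    | mem x hx =>
      obtain ⟨g', rfl⟩ := hx
      refine Submodule.subset_span ⟨g * g', ?_⟩
      simp
    | zero => simp
    | add x y _ _ hx hy => rw [map_add]; exact Submodule.add_mem _ hx hy
    | smul c x _ hx => rw [map_smul]; exact Submodule.smul_mem _ _ hx
  · have : v ∈ Submodule.span ℂ (Set.range fun g => ρ g v) :=
      Submodule.subset_span ⟨1, by simp⟩
    rwa [h0, Submodule.mem_bot] at this

theorem forall_mem_of_orbit {W : Type*} [AddCommGroup W] [Module ℂ W] {ρ : Representation ℂ G V}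
    (h : ρ.IsIrreducible) {v : V} (hv : v ≠ 0) (f : V →ₗ[ℂ] W) (Y : Submodule ℂ W)
    (hf : ∀ g, f (ρ g v) ∈ Y) (w : V) : f w ∈ Y := by
  have : (⊤ : Submodule ℂ V) ≤ Y.comap f := by
    rw [← span_orbit_eq_top h hv, Submodule.span_le]
    rintro _ ⟨g, rfl⟩
    exact hf g
  exact this trivial

theorem rep_eq_of_conj {i : A →* G} {χ : A →* ℂˣ} {ρ : Representation ℂ G V} {v : V} {a b : A}
    {g : G} (hv : v ∈ weightSpace i χ ρ) (h : i b = g * i a * g⁻¹) :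
    ρ (i b) (ρ g v) = (χ a : ℂ) • ρ g v := by
  rw [h, ← Module.End.mul_apply, ← map_mul, inv_mul_cancel_right, map_mul, Module.End.mul_apply,
    hv a, map_smul]

variable [Fintype A]

/-- The unnormalized projection onto the `χ`-weight space. -/
def weightProj (i : A →* G) (χ : A →* ℂˣ) (ρ : Representation ℂ G V) : V →ₗ[ℂ] V :=
  ∑ a, ((χ a)⁻¹ : ℂˣ).val • ρ (i a)

theorem weightProj_apply (i : A →* G) (χ : A →* ℂˣ) (ρ : Representation ℂ G V) (v : V) :
    weightProj i χ ρ v = ∑ a, ((χ a)⁻¹ : ℂˣ).val • ρ (i a) v := by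
  simp [weightProj]

theorem weightProj_mem (i : A →* G) (χ : A →* ℂˣ) (ρ : Representation ℂ G V) (v : V) :
    weightProj i χ ρ v ∈ weightSpace i χ ρ := by
  intro b
  rw [weightProj_apply, map_sum, Finset.smul_sum,
    ← Equiv.sum_comp (Equiv.mulLeft b) fun a => (χ b : ℂ) • ((χ a)⁻¹ : ℂˣ).val • ρ (i a) v]
  refine Finset.sum_congr rfl fun a _ => ?_
  change _ = (χ b : ℂ) • ((χ (b * a))⁻¹ : ℂˣ).val • ρ (i (b * a)) v
  rw [map_smul, ← Module.End.mul_apply, ← map_mul, ← map_mul, smul_smul,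
    map_mul χ, mul_inv_rev, mul_comm ((χ b : ℂˣ) : ℂ), ← Units.val_mul, inv_mul_cancel_right]

theorem weightProj_rep (i : A →* G) (χ : A →* ℂˣ) (ρ : Representation ℂ G V) (a : A) (v : V) :
    weightProj i χ ρ (ρ (i a) v) = (χ a : ℂ) • weightProj i χ ρ v := by
  rw [weightProj_apply, weightProj_apply, Finset.smul_sum,
    ← Equiv.sum_comp (Equiv.mulRight a) fun b => (χ a : ℂ) • ((χ b)⁻¹ : ℂˣ).val • ρ (i b) v]
  refine Finset.sum_congr rfl fun b _ => ?_
  change _ = (χ a : ℂ) • ((χ (b * a))⁻¹ : ℂˣ).val • ρ (i (b * a)) v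
  rw [← Module.End.mul_apply, ← map_mul, ← map_mul, smul_smul,
    map_mul χ, mul_inv_rev, ← Units.val_mul, mul_inv_cancel_left]

theorem weightProj_of_mem {i : A →* G} {χ : A →* ℂˣ} {ρ : Representation ℂ G V} {v : V}
    (hv : v ∈ weightSpace i χ ρ) : weightProj i χ ρ v = (Fintype.card A : ℂ) • v := by
  rw [weightProj_apply, Finset.sum_congr rfl fun a _ => by
    rw [hv a, smul_smul, ← Units.val_mul, inv_mul_cancel, Units.val_one, one_smul],
    Finset.sum_const, Finset.card_univ, Nat.cast_smul_eq_nsmul]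

theorem weightProj_eq_zero {i : A →* G} {χ : A →* ℂˣ} {ρ : Representation ℂ G V} {v : V} {a : A}
    {c : ℂ} (hv : ρ (i a) v = c • v) (hc : (χ a : ℂ) ≠ c) : weightProj i χ ρ v = 0 := by
  have h := weightProj_rep i χ ρ a v
  rw [hv, map_smul, ← sub_eq_zero, ← sub_smul, smul_eq_zero, sub_eq_zero] at h
  exact h.resolve_left hc.symm

theorem card_ne_zero_complex : (Fintype.card A : ℂ) ≠ 0 := by
  exact_mod_cast Fintype.card_ne_zero

/-- If `g` does not carry `χ` to `χ'`, some `i b` acts on `ρ g v` by a scalar other than `χ' b`, and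
the projection kills such vectors. -/
theorem weightProj_rep_eq_zero {i : A →* G} {χ χ' : A →* ℂˣ} {ρ : Representation ℂ G V} {v : V}
    (hv : v ∈ weightSpace i χ ρ) {g : G} (h : ¬ ∀ a b, i b = g * i a * g⁻¹ → χ' b = χ a) :
    weightProj i χ' ρ (ρ g v) = 0 := by
  push Not at h
  obtain ⟨a, b, hab, hne⟩ := h
  exact weightProj_eq_zero (rep_eq_of_conj hv hab) fun h => hne (Units.ext h)

end Weights

/-- The orbit of a `χ`-weight vector spans. Were no `g` to carry `χ` to `χ'`, the projection to
weight `χ'` would vanish on this orbit, hence everywhere. -/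
theorem exists_conj_of_hasWeight {A G V : Type*} [Group A] [Finite A] [Group G]
    [AddCommGroup V] [Module ℂ V] {i : A →* G} {χ χ' : A →* ℂˣ}
    {ρ : Representation ℂ G V} (hρ : ρ.IsIrreducible) (h : HasWeight i χ ρ)
    (h' : HasWeight i χ' ρ) : ∃ g, ∀ a b, i b = g * i a * g⁻¹ → χ' b = χ a := by
  have := Fintype.ofFinite A
  by_contra! hcon
  obtain ⟨v, hv, hw⟩ := h
  obtain ⟨v', hv', hw'⟩ := h'
  have := forall_mem_of_orbit hρ hv (weightProj i χ' ρ) ⊥ (fun g => by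
    rw [Submodule.mem_bot]
    refine weightProj_rep_eq_zero hw fun h => ?_
    obtain ⟨a, b, hab, hne⟩ := hcon g
    exact hne (h a b hab)) v'
  rw [Submodule.mem_bot, weightProj_of_mem hw'] at this
  exact smul_ne_zero card_ne_zero_complex hv' this

/-- Every finite-dimensional representation has a weight for a commutative group. -/
theorem exists_hasWeight {A G V : Type*} [CommGroup A] [Group G] [AddCommGroup V] [Module ℂ V]
    [FiniteDimensional ℂ V] [Nontrivial V] (i : A →* G) (ρ : Representation ℂ G V) :
    ∃ χ : A →* ℂˣ, HasWeight i χ ρ := by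
  -- On a minimal nonzero `A`-stable subspace each `a` acts by a scalar: commutativity makes its
  -- intersection with an eigenspace stable again. The scalars form the character.
  obtain ⟨W, ⟨hW, hW0⟩, hmin⟩ := (wellFounded_lt (α := Submodule ℂ V)).has_min
    {W | (∀ a, ∀ w ∈ W, ρ (i a) w ∈ W) ∧ W ≠ ⊥} ⟨⊤, fun _ _ _ => trivial, top_ne_bot⟩
  have key : ∀ a, ∃ c : ℂ, ∀ w ∈ W, ρ (i a) w = c • w := by
    intro a
    have : Nontrivial W := Submodule.nontrivial_iff_ne_bot.2 hW0
    obtain ⟨c, hc⟩ := Module.End.exists_eigenvalue ((ρ (i a)).restrict (hW a))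
    obtain ⟨w, hw⟩ := hc.exists_hasEigenvector
    have hw1 : ρ (i a) w = c • (w : V) := congrArg Subtype.val hw.apply_eq_smul
    refine ⟨c, fun u hu => ?_⟩
    have hle : W ⊓ Module.End.eigenspace (ρ (i a)) c ≤ W := inf_le_left
    have heq : W ⊓ Module.End.eigenspace (ρ (i a)) c = W := by
      by_contra hne
      refine hmin (W ⊓ Module.End.eigenspace (ρ (i a)) c) ⟨fun b x hx => ?_, fun h0 => ?_⟩
        (lt_of_le_of_ne hle hne)
      · refine Submodule.mem_inf.2 ⟨hW b x hx.1, ?_⟩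
        have hx2 := Module.End.mem_eigenspace_iff.1 hx.2
        rw [Module.End.mem_eigenspace_iff, ← map_smul, ← hx2, ← Module.End.mul_apply,
          ← Module.End.mul_apply, ← map_mul, ← map_mul, ← map_mul, ← map_mul, mul_comm]
      · have : (w : V) ∈ W ⊓ Module.End.eigenspace (ρ (i a)) c :=
          ⟨w.2, Module.End.mem_eigenspace_iff.2 hw1⟩
        rw [h0, Submodule.mem_bot] at this
        exact hw.2 (Subtype.ext this)
    rw [← heq] at hu
    exact Module.End.mem_eigenspace_iff.1 hu.2
  choose c hc using key
  obtain ⟨v, hv, hv0⟩ := W.ne_bot_iff.1 hW0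
  have hmul : ∀ a b, c (a * b) = c a * c b := fun a b => by
    apply smul_left_injective ℂ hv0
    change c (a * b) • v = (c a * c b) • v
    rw [← hc _ v hv, map_mul, map_mul, Module.End.mul_apply, hc b v hv, map_smul, hc a v hv,
      smul_smul, mul_comm]
  have hone : c 1 = 1 := by
    apply smul_left_injective ℂ hv0
    change c 1 • v = (1 : ℂ) • v
    rw [← hc _ v hv, map_one, map_one, one_smul, Module.End.one_apply]
  exact ⟨MonoidHom.toHomUnits ⟨⟨c, hone⟩, hmul⟩, v, hv0, fun a => hc a v hv⟩

/-! ### Clifford theory for an extendible linear character. -/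

/-- A subgroup `S` of `G` which is the stabilizer of the character `χ` of the normal subgroup
`i(A)`, an extension of `χ` to `S`, and an identification `S / i(A) ≅ H`. -/
structure Stabilizer {A G : Type*} [Group A] [Group G] (i : A →* G) (χ : A →* ℂˣ)
    (H : Type*) [Group H] where
  S : Subgroup G
  f : S →* H
  f_surjective : Function.Surjective f
  ext : S →* ℂˣ
  f_eq_one_iff : ∀ s : S, f s = 1 ↔ ∃ a, i a = s
  ext_apply : ∀ a (s : S), i a = s → ext s = χ a
  injective : Function.Injective i
  normal : ∀ g a, ∃ b, i b = g * i a * g⁻¹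
  mem_of_stab : ∀ g, (∀ a b, i b = g * i a * g⁻¹ → χ b = χ a) → g ∈ S

namespace Stabilizer

variable {A G H : Type*} [Group A] [Group G] [Group H] {i : A →* G} {χ : A →* ℂˣ}

section Twist

variable (D : Stabilizer i χ H) {W : Type*} [AddCommGroup W] [Module ℂ W]

theorem exists_mem (a : A) : ∃ s : D.S, i a = s ∧ D.f s = 1 ∧ D.ext s = χ a := by
  have h : i a ∈ D.S := by
    refine D.mem_of_stab _ fun b c hbc => ?_
    have hb : c = a * b * a⁻¹ := D.injective (by rw [hbc, map_mul, map_mul, map_inv])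
    rw [hb, map_mul, map_mul, map_inv, mul_comm (χ a), mul_inv_cancel_right]
  exact ⟨⟨i a, h⟩, rfl, (D.f_eq_one_iff _).2 ⟨a, rfl⟩, D.ext_apply _ _ rfl⟩

/-- The extension of `χ` to `S` takes values in a commutative group, so it is constant on
`S`-conjugates. This is why the structure only asks for one inclusion between `S` and the
stabilizer. -/
theorem conj_apply (s : D.S) {a b : A} (h : i b = s * i a * (s : G)⁻¹) : χ b = χ a := by
  obtain ⟨t, ht, -, htχ⟩ := D.exists_mem a
  rw [← D.ext_apply b (s * t * s⁻¹) (by rw [h, ht]; rfl), ← htχ, map_mul, map_mul, map_inv,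
    mul_comm (D.ext s), mul_inv_cancel_right]

theorem exists_conj (s : D.S) (b : A) : ∃ a, i b = s * i a * (s : G)⁻¹ ∧ χ b = χ a := by
  obtain ⟨a, ha⟩ := D.normal (s : G)⁻¹ b
  have h : i b = s * i a * (s : G)⁻¹ := by rw [ha]; group
  exact ⟨a, h, D.conj_apply s h⟩

/-- The inflation of `τ` from `H` to `S`, twisted by the extension of `χ`. -/
def twist (τ : Representation ℂ H W) : Representation ℂ D.S W where
  toFun s := (D.ext s : ℂ) • τ (D.f s)
  map_one' := by simp
  map_mul' s t := by
    ext w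
    simp only [map_mul, Units.val_mul, LinearMap.smul_apply, Module.End.mul_apply, map_smul,
      mul_smul]
    rw [smul_comm]

theorem twist_apply (τ : Representation ℂ H W) (s : D.S) (w : W) :
    D.twist τ s w = (D.ext s : ℂ) • τ (D.f s) w := rfl

/-- The representation of `G` (co)induced from the twisted inflation of `τ`. -/
abbrev coind (τ : Representation ℂ H W) :
    Representation ℂ G (Representation.coindV D.S.subtype (D.twist τ)) :=
  Representation.coind D.S.subtype (D.twist τ)

theorem coindV_apply {τ : Representation ℂ H W}
    (F : Representation.coindV D.S.subtype (D.twist τ)) (s : D.S) (g : G) :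
    F.1 (s * g) = D.twist τ s (F.1 g) := F.2 s g

theorem coind_apply_apply (τ : Representation ℂ H W)
    (F : Representation.coindV D.S.subtype (D.twist τ)) (g x : G) :
    (D.coind τ g F).1 x = F.1 (x * g) := rfl

theorem finrank_coindV [Finite G] [FiniteDimensional ℂ W] (τ : Representation ℂ H W) :
    Module.finrank ℂ (Representation.coindV D.S.subtype (D.twist τ)) =
      D.S.index * Module.finrank ℂ W := by
  -- An equivariant function is determined freely by its values on a right transversal; that the
  -- transversal contains 1 plays no role.
  obtain ⟨T, hT, -⟩ := D.S.exists_isComplement_right 1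
  let e : Representation.coindV D.S.subtype (D.twist τ) ≃ₗ[ℂ] (T → W) :=
    { toFun F t := F.1 t
      map_add' _ _ := rfl
      map_smul' _ _ := rfl
      invFun φ := ⟨fun g => D.twist τ (hT.equiv g).1 (φ (hT.equiv g).2), fun s g => by
        simp only [Subgroup.coe_subtype]
        rw [hT.equiv_mul_left s g]
        simp only [map_mul, Module.End.mul_apply]⟩
      left_inv F := by
        apply Subtype.ext
        funext g
        change D.twist τ (hT.equiv g).1 (F.1 (hT.equiv g).2) = F.1 g
        rw [← D.coindV_apply, hT.equiv_fst_mul_equiv_snd]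
      right_inv φ := by
        funext t
        have : hT.equiv (t : G) = (1, t) := by
          rw [← Equiv.eq_symm_apply]
          exact ((hT.equiv_symm_apply ((1 : D.S), t)).trans (one_mul _)).symm
        change D.twist τ (hT.equiv (t : G)).1 (φ (hT.equiv (t : G)).2) = φ t
        rw [this]
        simp }
  have := Fintype.ofFinite T
  rw [e.finrank_eq, Module.finrank_pi_fintype, Finset.sum_const, Finset.card_univ, smul_eq_mul,
    ← hT.card_right, Nat.card_eq_fintype_card]

open Classical in
/-- The functions supported on `S`. -/
def sect (τ : Representation ℂ H W) :
    W →ₗ[ℂ] Representation.coindV D.S.subtype (D.twist τ) where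
  toFun w := ⟨fun g => if h : g ∈ D.S then D.twist τ ⟨g, h⟩ w else 0, fun s g => by
    by_cases h : g ∈ D.S
    · have h' : (D.S.subtype s) * g ∈ D.S := D.S.mul_mem s.2 h
      simp only [dif_pos h, dif_pos h']
      rw [← Module.End.mul_apply, ← map_mul]
      rfl
    · have h' : (D.S.subtype s) * g ∉ D.S := fun h' => h ((D.S.mul_mem_cancel_left s.2).1 h')
      simp only [dif_neg h, dif_neg h', map_zero]⟩
  map_add' v w := by
    apply Subtype.ext
    funext g
    by_cases h : g ∈ D.S <;> simp [h]
  map_smul' c w := by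
    apply Subtype.ext
    funext g
    by_cases h : g ∈ D.S <;> simp [h]

theorem sect_apply_mem (τ : Representation ℂ H W) (w : W) (s : D.S) :
    (D.sect τ w).1 s = D.twist τ s w := dif_pos s.2

theorem sect_apply_one (τ : Representation ℂ H W) (w : W) : (D.sect τ w).1 1 = w := by
  have := D.sect_apply_mem τ w 1
  rwa [map_one] at this

theorem sect_apply_not_mem (τ : Representation ℂ H W) (w : W) {g : G} (h : g ∉ D.S) :
    (D.sect τ w).1 g = 0 := dif_neg h

theorem coind_sect (τ : Representation ℂ H W) (w : W) (s : D.S) :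
    D.coind τ s (D.sect τ w) = D.sect τ (D.twist τ s w) := by
  apply Subtype.ext
  funext g
  rw [D.coind_apply_apply]
  by_cases h : g ∈ D.S
  · lift g to D.S using h
    rw [D.sect_apply_mem, ← Subgroup.coe_mul, D.sect_apply_mem, map_mul, Module.End.mul_apply]
  · rw [D.sect_apply_not_mem _ _ h, D.sect_apply_not_mem]
    exact fun h' => h ((D.S.mul_mem_cancel_right s.2).1 h')

theorem sect_rep (τ : Representation ℂ H W) (w : W) (s : D.S) :
    D.sect τ (τ (D.f s) w) = ((D.ext s)⁻¹ : ℂˣ).val • D.coind τ s (D.sect τ w) := by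
  rw [D.coind_sect, twist_apply, map_smul, smul_smul, ← Units.val_mul, inv_mul_cancel,
    Units.val_one, one_smul]

theorem sect_mem_weightSpace (τ : Representation ℂ H W) (w : W) :
    D.sect τ w ∈ weightSpace i χ (D.coind τ) := by
  intro a
  obtain ⟨s, hs, hf, hχ⟩ := D.exists_mem a
  rw [hs, D.coind_sect, twist_apply, hf, map_one, Module.End.one_apply, map_smul, hχ]

/-- Together with `sect_mem_weightSpace` this identifies the `χ`-weight space with a copy of `W`.
For `g` outside `S` some `a` has `χ (g a g⁻¹) ≠ χ a`, and evaluating the action of `i a` at `g` in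
two ways forces `F.1 g = 0`. -/
theorem eq_sect_of_mem (τ : Representation ℂ H W)
    {F : Representation.coindV D.S.subtype (D.twist τ)} (hF : F ∈ weightSpace i χ (D.coind τ)) :
    F = D.sect τ (F.1 1) := by
  apply Subtype.ext
  funext g
  by_cases h : g ∈ D.S
  · lift g to D.S using h
    rw [D.sect_apply_mem, ← D.coindV_apply, mul_one]
  · rw [D.sect_apply_not_mem _ _ h]
    by_contra hg
    refine h (D.mem_of_stab g fun a b hab => ?_)
    have h1 : (D.coind τ (i a) F).1 g = (χ a : ℂ) • F.1 g :=
      congrFun (congrArg Subtype.val (hF a)) g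
    obtain ⟨s, hs, hf, hχ⟩ := D.exists_mem b
    have h2 : g * i a = s * g := by rw [← hs, hab]; group
    rw [D.coind_apply_apply, h2, D.coindV_apply, twist_apply, hf, hχ, map_one,
      Module.End.one_apply] at h1
    exact Units.ext (smul_left_injective ℂ hg h1)

/-- Hence the translates of the functions supported on `S` span the coinduced space. The factor
appears because each coset of `S` is counted once per element. -/
theorem card_smul_eq_sum [Fintype G] (τ : Representation ℂ H W)
    (F : Representation.coindV D.S.subtype (D.twist τ)) :
    (Nat.card D.S : ℂ) • F = ∑ g, D.coind τ g⁻¹ (D.sect τ (F.1 g)) := by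
  classical
  apply Subtype.ext
  funext x
  have h1 : ∀ g, (D.coind τ g⁻¹ (D.sect τ (F.1 g))).1 x = if x * g⁻¹ ∈ D.S then F.1 x else 0 := by
    intro g
    rw [D.coind_apply_apply]
    split_ifs with h
    · have := D.sect_apply_mem τ (F.1 g) ⟨x * g⁻¹, h⟩
      rw [← D.coindV_apply] at this
      simpa using this
    · rw [D.sect_apply_not_mem _ _ h]
  rw [Submodule.coe_sum, Finset.sum_apply, Finset.sum_congr rfl fun g _ => h1 g,
    Fintype.sum_equiv (Equiv.divLeft x) _ (fun y => if y ∈ D.S then F.1 x else 0)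
      fun g => by simp [div_eq_mul_inv], ← Finset.sum_filter, Finset.sum_const,
      ← Nat.cast_smul_eq_nsmul ℂ, Nat.card_eq_fintype_card, Fintype.card_subtype]
  rfl

/-- A nonzero stable `X` contains a function nonzero at 1, after a translation. Its weight
projection is again in `X` and is `sect` of a nonzero vector, so by irreducibility of `τ` all of
`sect` lies in `X`, and this generates everything. -/
theorem coind_irreducible [Finite G] [Finite A] {τ : Representation ℂ H W}
    (hτ : τ.IsIrreducible) : (D.coind τ).IsIrreducible := by
  have := Fintype.ofFinite G
  have := Fintype.ofFinite A
  rw [isIrreducible_iff] at hτ ⊢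
  obtain ⟨hW, hτ⟩ := hτ
  refine ⟨Function.Injective.nontrivial (f := D.sect τ) fun v w h => ?_, fun X hX => ?_⟩
  · rw [← D.sect_apply_one τ v, h, D.sect_apply_one]
  by_cases hX0 : X = ⊥
  · exact Or.inl hX0
  right
  have hY : X.comap (D.sect τ) = ⊤ := by
    refine (hτ (X.comap (D.sect τ)) fun h w hw => ?_).resolve_left fun h0 => ?_
    · obtain ⟨s, rfl⟩ := D.f_surjective h
      rw [Submodule.mem_comap, D.sect_rep]
      exact X.smul_mem _ (hX _ _ hw)
    · obtain ⟨F, hF, hF0⟩ := X.ne_bot_iff.1 hX0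
      obtain ⟨x, hx⟩ : ∃ x, F.1 x ≠ 0 := by
        by_contra! hall
        exact hF0 (Subtype.ext (funext hall))
      let F' := D.coind τ x F
      have hF' : F' ∈ X := hX _ _ hF
      have h1 : F'.1 1 ≠ 0 := by
        rw [D.coind_apply_apply, one_mul]
        exact hx
      have hP : weightProj i χ (D.coind τ) F' ∈ X := by
        rw [weightProj_apply]
        exact X.sum_mem fun a _ => X.smul_mem _ (hX _ _ hF')
      have hP1 : (weightProj i χ (D.coind τ) F').1 1 = (Fintype.card A : ℂ) • F'.1 1 := by
        rw [weightProj_apply, Submodule.coe_sum, Finset.sum_apply,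
          Finset.sum_congr rfl fun a _ => ?_, Finset.sum_const, Finset.card_univ,
          Nat.cast_smul_eq_nsmul]
        obtain ⟨s, hs, hf, hχ⟩ := D.exists_mem a
        change ((χ a)⁻¹ : ℂˣ).val • (D.coind τ (i a) F').1 1 = _
        rw [D.coind_apply_apply, one_mul, hs, ← mul_one (s : G), D.coindV_apply, twist_apply, hf,
          hχ, map_one, Module.End.one_apply, smul_smul, ← Units.val_mul, inv_mul_cancel,
          Units.val_one, one_smul]
      rw [D.eq_sect_of_mem τ (weightProj_mem i χ _ F'), hP1] at hP
      have : (Fintype.card A : ℂ) • F'.1 1 ∈ X.comap (D.sect τ) := hP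
      rw [h0, Submodule.mem_bot] at this
      exact smul_ne_zero card_ne_zero_complex h1 this
  rw [eq_top_iff]
  intro F _
  have hc : (Nat.card D.S : ℂ) ≠ 0 := by exact_mod_cast Nat.card_pos.ne'
  have : (Nat.card D.S : ℂ) • F ∈ X := by
    rw [D.card_smul_eq_sum]
    refine X.sum_mem fun g _ => hX _ _ ?_
    have : F.1 g ∈ X.comap (D.sect τ) := by rw [hY]; trivial
    exact this
  exact (X.smul_mem_iff hc).1 this

/-- An isomorphism preserves `χ`-weight spaces, which are copies of `W` and `W'`; evaluation at 1
reads off the induced map, and Schur's lemma finishes. -/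
theorem equiv_of_coind_equiv {W' : Type*} [AddCommGroup W'] [Module ℂ W']
    {τ : Representation ℂ H W} {τ' : Representation ℂ H W'} (hτ : τ.IsIrreducible)
    (hτ' : τ'.IsIrreducible) (e : (D.coind τ).Equiv (D.coind τ')) : Nonempty (τ.Equiv τ') := by
  let ev : Representation.coindV D.S.subtype (D.twist τ') →ₗ[ℂ] W' :=
    (LinearMap.proj (1 : G)) ∘ₗ Submodule.subtype _
  have hev : ∀ F, ev F = F.1 1 := fun _ => rfl
  let f : W →ₗ[ℂ] W' := ev ∘ₗ e.toLinearEquiv.toLinearMap ∘ₗ D.sect τ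
  have hf : ∀ w, f w = (e (D.sect τ w)).1 1 := fun _ => rfl
  refine equiv_of_intertwiningMap hτ hτ' f (fun h w => ?_) fun h0 => ?_
  · obtain ⟨s, rfl⟩ := D.f_surjective h
    rw [hf, D.sect_rep]
    have : e (((D.ext s)⁻¹ : ℂˣ).val • D.coind τ s (D.sect τ w)) =
        ((D.ext s)⁻¹ : ℂˣ).val • D.coind τ' s (e (D.sect τ w)) := by
      rw [← equiv_apply_rep e]
      exact map_smul e.toLinearEquiv _ _
    rw [this]
    change ((D.ext s)⁻¹ : ℂˣ).val • (D.coind τ' s (e (D.sect τ w))).1 1 = _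
    rw [D.coind_apply_apply, one_mul, ← mul_one (s : G), D.coindV_apply, twist_apply, smul_smul,
      ← Units.val_mul, inv_mul_cancel, Units.val_one, one_smul, hf]
  · have := ((isIrreducible_iff _).1 hτ).1
    obtain ⟨w, hw⟩ := exists_ne (0 : W)
    have h1 : e (D.sect τ w) ∈ weightSpace i χ (D.coind τ') := by
      intro a
      rw [← equiv_apply_rep e, D.sect_mem_weightSpace τ w a]
      exact map_smul e.toLinearEquiv _ _
    have h2 : e (D.sect τ w) = 0 := by
      rw [D.eq_sect_of_mem τ' h1, ← hf, h0, LinearMap.zero_apply, map_zero]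
    have h3 : D.sect τ w = 0 := (LinearEquiv.map_eq_zero_iff e.toLinearEquiv).1 h2
    apply hw
    rw [← D.sect_apply_one τ w, h3]
    rfl

end Twist

section Restrict

variable (D : Stabilizer i χ H) {V : Type*} [AddCommGroup V] [Module ℂ V]

theorem rep_mem (ρ : Representation ℂ G V) (s : D.S) {v : V} (hv : v ∈ weightSpace i χ ρ) :
    ρ s v ∈ weightSpace i χ ρ :=
  rep_mem_weightSpace (D.exists_conj s) hv

/-- The untwisted action of the stabilizer on the weight space. -/
def weightRepAux (ρ : Representation ℂ G V) : D.S →* Module.End ℂ (weightSpace i χ ρ) where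
  toFun s := ((D.ext s)⁻¹ : ℂˣ).val • (ρ s).restrict fun _ hv => D.rep_mem ρ s hv
  map_one' := by
    ext v
    simp
  map_mul' s t := by
    ext v
    simp [mul_smul]

theorem weightRepAux_apply (ρ : Representation ℂ G V) (s : D.S) (v : weightSpace i χ ρ) :
    (D.weightRepAux ρ s v : V) = ((D.ext s)⁻¹ : ℂˣ).val • ρ s v := rfl

theorem ker_le_ker_weightRepAux (ρ : Representation ℂ G V) :
    D.f.ker ≤ (D.weightRepAux ρ).toHomUnits.ker := fun s hs => by
  obtain ⟨a, ha⟩ := (D.f_eq_one_iff s).1 hs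
  rw [MonoidHom.mem_ker]
  ext v
  change (D.weightRepAux ρ s v : V) = v
  rw [D.weightRepAux_apply, ← ha, v.2 a, D.ext_apply a s ha, smul_smul, ← Units.val_mul,
    inv_mul_cancel, Units.val_one, one_smul]

/-- The representation of `H = S / i(A)` on the `χ`-weight space. -/
def weightRep (ρ : Representation ℂ G V) : Representation ℂ H (weightSpace i χ ρ) :=
  (Units.coeHom _).comp <| D.f.liftOfSurjective D.f_surjective
    ⟨(D.weightRepAux ρ).toHomUnits, D.ker_le_ker_weightRepAux ρ⟩

theorem weightRep_f (ρ : Representation ℂ G V) (s : D.S) (v : weightSpace i χ ρ) :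
    (D.weightRep ρ (D.f s) v : V) = ((D.ext s)⁻¹ : ℂˣ).val • ρ s v := by
  have : D.weightRep ρ (D.f s) = D.weightRepAux ρ s :=
    congrArg Units.val (D.f.liftOfRightInverse_comp_apply _
      (Function.rightInverse_surjInv D.f_surjective)
      ⟨(D.weightRepAux ρ).toHomUnits, D.ker_le_ker_weightRepAux ρ⟩ s)
  rw [this, weightRepAux_apply]

/-- For a nonzero `y` in a stable subspace `Y`, the weight projection of `ρ g y` lies in `Y` if `g ∈
S` and is zero otherwise. As the orbit of `y` spans, the whole weight space is in `Y`. -/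
theorem weightRep_irreducible [Finite A] {ρ : Representation ℂ G V} (hρ : ρ.IsIrreducible)
    (h : HasWeight i χ ρ) : (D.weightRep ρ).IsIrreducible := by
  have := Fintype.ofFinite A
  obtain ⟨v, hv, hw⟩ := h
  rw [isIrreducible_iff]
  refine ⟨⟨⟨v, hw⟩, 0, fun h => hv (congrArg Subtype.val h)⟩, fun Y hY => ?_⟩
  by_cases hY0 : Y = ⊥
  · exact Or.inl hY0
  right
  obtain ⟨y, hy, hy0⟩ := Y.ne_bot_iff.1 hY0
  have hy0' : (y : V) ≠ 0 := fun h => hy0 (Subtype.ext h)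
  have key := forall_mem_of_orbit hρ hy0' (weightProj i χ ρ) (Y.map (Submodule.subtype _))
    fun g => ?_
  · rw [eq_top_iff]
    intro w _
    have := key w
    rw [weightProj_of_mem w.2, Submodule.smul_mem_iff _ card_ne_zero_complex] at this
    obtain ⟨w', hw', hww⟩ := this
    rwa [← Subtype.ext hww]
  · by_cases hg : g ∈ D.S
    · lift g to D.S using hg
      rw [weightProj_of_mem (D.rep_mem ρ g y.2)]
      refine Submodule.smul_mem _ _ ⟨(D.ext g : ℂ) • D.weightRep ρ (D.f g) y,
        Y.smul_mem _ (hY _ _ hy), ?_⟩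
      change (D.ext g : ℂ) • (D.weightRep ρ (D.f g) y : V) = _
      rw [D.weightRep_f, smul_smul, ← Units.val_mul, mul_inv_cancel, Units.val_one, one_smul]
    · rw [weightProj_rep_eq_zero y.2 fun h => hg (D.mem_of_stab g h)]
      exact Submodule.zero_mem _

theorem weightProj_rep_comm [Fintype A] (ρ : Representation ℂ G V) (s : D.S) (v : V) :
    weightProj i χ ρ (ρ s v) = ρ s (weightProj i χ ρ v) := by
  choose c hc using D.normal s
  have hcb : Function.Bijective c := by
    refine Finite.injective_iff_bijective.1 fun a b hab => D.injective ?_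
    have := hc a
    rw [hab, hc b] at this
    exact (mul_left_cancel (mul_right_cancel this)).symm
  rw [weightProj_apply, weightProj_apply, map_sum,
    ← hcb.sum_comp fun b => ((χ b)⁻¹ : ℂˣ).val • ρ (i b) (ρ s v)]
  refine Finset.sum_congr rfl fun a _ => ?_
  rw [D.conj_apply s (hc a), hc a, map_smul, ← Module.End.mul_apply, ← map_mul,
    inv_mul_cancel_right, map_mul, Module.End.mul_apply]

/-- Frobenius reciprocity: `v ↦ (g ↦ Q (ρ g v))`, with `Q` the projection to the weight space
followed by `e`, is a nonzero intertwiner between irreducibles. -/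
theorem equiv_coind_weightRep [Finite G] [Finite A] {W : Type*} [AddCommGroup W] [Module ℂ W]
    {ρ : Representation ℂ G V} (hρ : ρ.IsIrreducible) (h : HasWeight i χ ρ)
    {τ : Representation ℂ H W} (e : (D.weightRep ρ).Equiv τ) :
    Nonempty ((D.coind τ).Equiv ρ) := by
  have := Fintype.ofFinite A
  have hτ : τ.IsIrreducible := IsIrreducible.of_equiv e (D.weightRep_irreducible hρ h)
  let P : V →ₗ[ℂ] weightSpace i χ ρ := (weightProj i χ ρ).codRestrict _ (weightProj_mem i χ ρ)
  have hP : ∀ (s : D.S) v, P (ρ s v) = (D.ext s : ℂ) • D.weightRep ρ (D.f s) (P v) := by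
    intro s v
    apply Subtype.ext
    change weightProj i χ ρ (ρ s v) = (D.ext s : ℂ) • (D.weightRep ρ (D.f s) (P v) : V)
    rw [D.weightRep_f, smul_smul, ← Units.val_mul, mul_inv_cancel, Units.val_one, one_smul,
      D.weightProj_rep_comm]
    rfl
  let Q : V →ₗ[ℂ] W := e.toLinearEquiv.toLinearMap ∘ₗ P
  have hQ : ∀ (s : D.S) v, Q (ρ s v) = D.twist τ s (Q v) := by
    intro s v
    change e.toLinearEquiv (P (ρ s v)) = (D.ext s : ℂ) • τ (D.f s) (e (P v))
    rw [hP, map_smul, ← equiv_apply_rep e]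
    rfl
  let Φ : V →ₗ[ℂ] Representation.coindV D.S.subtype (D.twist τ) :=
    { toFun v := ⟨fun g => Q (ρ g v), fun s g => by
        simp only [map_mul, Module.End.mul_apply]
        exact hQ s _⟩
      map_add' v w := by
        apply Subtype.ext
        funext g
        simp
      map_smul' c v := by
        apply Subtype.ext
        funext g
        simp }
  refine (equiv_of_intertwiningMap hρ (D.coind_irreducible hτ) Φ (fun g v => ?_)
    fun h0 => ?_).map Representation.Equiv.symm
  · apply Subtype.ext
    funext x
    rw [D.coind_apply_apply]
    change Q (ρ x (ρ g v)) = Q (ρ (x * g) v)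
    rw [map_mul, Module.End.mul_apply]
  · obtain ⟨v, hv, hw⟩ := h
    have h1 : Q (ρ 1 v) = 0 := by
      change (Φ v).1 1 = 0
      rw [h0]
      rfl
    rw [map_one, Module.End.one_apply] at h1
    have h2 : P v = 0 := (LinearEquiv.map_eq_zero_iff e.toLinearEquiv).1 h1
    have h3 : weightProj i χ ρ v = 0 := congrArg Subtype.val h2
    rw [weightProj_of_mem hw] at h3
    exact smul_ne_zero card_ne_zero_complex hv h3

theorem hasWeight_coind {W : Type*} [AddCommGroup W] [Module ℂ W] {τ : Representation ℂ H W}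
    (hτ : τ.IsIrreducible) : HasWeight i χ (D.coind τ) := by
  have := ((isIrreducible_iff _).1 hτ).1
  obtain ⟨w, hw⟩ := exists_ne (0 : W)
  refine ⟨D.sect τ w, fun h => hw ?_, D.sect_mem_weightSpace τ w⟩
  rw [← D.sect_apply_one τ w, h]
  rfl

end Restrict

/-- Clifford theory: the irreducible representations of `G` lying over a character `χ` of a normal
subgroup which extends to its stabilizer `S`. -/
theorem zetaOn_hasWeight [Finite G] [Finite A] [Finite H] (D : Stabilizer i χ H) :
    zetaOn {r : Irr G | HasWeight i χ r.rep} = (zeta H).comp (Polynomial.X ^ D.S.index) := by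
  choose F hF using fun r : Irr H => Irr.exists_equiv _ (D.coind_irreducible r.rep_irreducible)
  refine zetaOn_eq_of_bijOn _ _ F (fun r s hrs => ?_) ?_ fun r => ?_
  · obtain ⟨e⟩ := hF r
    obtain ⟨e'⟩ := hF s
    rw [← hrs] at e'
    exact Irr.eq_of_equiv
      (D.equiv_of_coind_equiv r.rep_irreducible s.rep_irreducible (e.trans e'.symm))
  · ext r
    constructor
    · rintro ⟨s, rfl⟩
      obtain ⟨e⟩ := hF s
      exact (D.hasWeight_coind s.rep_irreducible).of_equiv e
    · intro hr
      obtain ⟨s, ⟨e⟩⟩ := Irr.exists_equiv _ (D.weightRep_irreducible r.rep_irreducible hr)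
      obtain ⟨e'⟩ := D.equiv_coind_weightRep r.rep_irreducible hr e
      obtain ⟨e''⟩ := hF s
      exact ⟨s, Irr.eq_of_equiv ⟨e''.symm.trans e'⟩⟩
  · obtain ⟨e⟩ := hF r
    rw [Irr.dim_eq_of_equiv e, D.finrank_coindV, r.dim_eq]

end Stabilizer

/-! ### Commutative groups and isomorphism invariance. -/

section Comm

variable {G : Type*} [Group G]

/-- The one-dimensional representation attached to a linear character. -/
def charRep (χ : G →* ℂˣ) : Representation ℂ G ℂ where
  toFun g := (χ g : ℂ) • LinearMap.id
  map_one' := by ext; simp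
  map_mul' g h := by ext; simp [mul_comm]

theorem charRep_apply (χ : G →* ℂˣ) (g : G) (z : ℂ) : charRep χ g z = χ g * z := rfl

theorem charRep_irreducible (χ : G →* ℂˣ) : (charRep χ).IsIrreducible := by
  rw [isIrreducible_iff]
  refine ⟨inferInstance, fun W _ => ?_⟩
  exact eq_bot_or_eq_top W

theorem eq_of_charRep_equiv {χ χ' : G →* ℂˣ} (e : (charRep χ).Equiv (charRep χ')) : χ = χ' := by
  ext g
  have h := equiv_apply_rep e g 1
  have h1 : charRep χ g 1 = (χ g : ℂ) • (1 : ℂ) := rfl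
  have h2 : e ((χ g : ℂ) • (1 : ℂ)) = (χ g : ℂ) • e 1 := map_smul e.toLinearEquiv _ _
  rw [charRep_apply χ', h1, h2, smul_eq_mul] at h
  refine mul_right_cancel₀ (b := e 1) (fun h0 => ?_) h
  exact one_ne_zero ((LinearEquiv.map_eq_zero_iff e.toLinearEquiv).1 h0)

theorem zeta_of_comm {G : Type*} [CommGroup G] [Finite G] :
    zeta G = (Nat.card G : ℤ[X]) * Polynomial.X := by
  choose F hF using fun χ : G →* ℂˣ => Irr.exists_equiv _ (charRep_irreducible χ)
  have hFb : Function.Bijective F := by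
    constructor
    · intro χ χ' h
      obtain ⟨e⟩ := hF χ
      obtain ⟨e'⟩ := hF χ'
      rw [← h] at e'
      exact eq_of_charRep_equiv (e.trans e'.symm)
    · intro r
      have := ((isIrreducible_iff _).1 r.rep_irreducible).1
      obtain ⟨χ, v, hv, hw⟩ := exists_hasWeight (MonoidHom.id G) r.rep
      obtain ⟨e⟩ := hF χ
      obtain ⟨e'⟩ : Nonempty ((charRep χ).Equiv r.rep) := by
        refine equiv_of_intertwiningMap (charRep_irreducible χ) r.rep_irreducible
          (LinearMap.toSpanSingleton ℂ _ v) (fun g z => ?_) fun h => hv ?_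
        · have h1 : r.rep g v = (χ g : ℂ) • v := hw g
          rw [charRep_apply, LinearMap.toSpanSingleton_apply, LinearMap.toSpanSingleton_apply,
            map_smul, h1, smul_smul, mul_comm]
        · have := LinearMap.congr_fun h 1
          simpa using this
      exact ⟨χ, Irr.eq_of_equiv ⟨e.symm.trans e'⟩⟩
  have hd : ∀ r : Irr G, r.dim = 1 := by
    intro r
    obtain ⟨χ, rfl⟩ := hFb.2 r
    obtain ⟨e⟩ := hF χ
    rw [Irr.dim_eq_of_equiv e, Module.finrank_self]
  have := Fintype.ofFinite (Irr G)
  rw [zeta, finsum_eq_sum_of_fintype, Finset.sum_congr rfl fun r _ => by rw [hd r, pow_one],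
    Finset.sum_const, Finset.card_univ, ← Nat.card_eq_fintype_card,
    ← Nat.card_congr (Equiv.ofBijective F hFb),
    CommGroup.card_monoidHom_of_hasEnoughRootsOfUnity, nsmul_eq_mul]

theorem zeta_of_forall_mul_comm [Finite G] (h : ∀ a b : G, a * b = b * a) :
    zeta G = (Nat.card G : ℤ[X]) * Polynomial.X :=
  letI : CommGroup G := { (inferInstance : Group G) with mul_comm := h }
  zeta_of_comm

/-- The degenerate case of Clifford theory with a trivial normal subgroup: every irreducible lies
over its trivial character, and `S = ⊤` has quotient `H` through `e`. -/
theorem zeta_congr {H : Type*} [Group H] [Finite G] [Finite H] (e : G ≃* H) : zeta G = zeta H := by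
  let D : Stabilizer (1 : Unit →* G) 1 H :=
    { S := ⊤
      f := e.toMonoidHom.comp (⊤ : Subgroup G).subtype
      f_surjective := fun h => ⟨⟨e.symm h, trivial⟩, e.apply_symm_apply h⟩
      ext := 1
      f_eq_one_iff := fun s => by
        constructor
        · intro h
          refine ⟨1, ?_⟩
          have : e (s : G) = 1 := h
          rw [map_one]
          exact ((map_eq_one_iff e e.injective).1 this).symm
        · rintro ⟨_, h⟩
          change e (s : G) = 1
          rw [← h, MonoidHom.one_apply, map_one]
      ext_apply := fun _ _ _ => rfl
      injective := Function.injective_of_subsingleton _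
      normal := fun g _ => ⟨1, by simp⟩
      mem_of_stab := fun _ _ => trivial }
  have h1 : zetaOn {r : Irr G | HasWeight (1 : Unit →* G) 1 r.rep} = zeta G := by
    rw [zeta_eq_sum_zetaOn (fun _ : Unit => {r : Irr G | HasWeight (1 : Unit →* G) 1 r.rep}),
      Fintype.sum_unique]
    intro r
    refine ⟨(), ?_, fun _ _ => rfl⟩
    have := ((isIrreducible_iff _).1 r.rep_irreducible).1
    obtain ⟨v, hv⟩ := exists_ne (0 : Fin (Quotient.out r).1 → ℂ)
    exact ⟨v, hv, fun a => by simp⟩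
  rw [← h1, D.zetaOn_hasWeight]
  have : D.S.index = 1 := Subgroup.index_top
  rw [this, pow_one, Polynomial.comp_X]

end Comm

/-! ### Duality for finite vector spaces through one additive character. -/

section FieldCharacters

variable {K : Type*} [Field K]

theorem exists_char_ne_one [Finite K] : ∃ ψ : Multiplicative K →* ℂˣ, ψ ≠ 1 := by
  obtain ⟨ψ, hψ⟩ := CommGroup.exists_apply_ne_one_of_hasEnoughRootsOfUnity (Multiplicative K) ℂ
    (a := Multiplicative.ofAdd (1 : K)) (fun h => one_ne_zero (congrArg Multiplicative.toAdd h))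
  exact ⟨ψ, fun h => hψ (by rw [h]; rfl)⟩

variable {V V' : Type*} [AddCommGroup V] [Module K V] [AddCommGroup V'] [Module K V']

theorem eq_zero_of_char_eq_one {ψ : Multiplicative K →* ℂˣ} (hψ : ψ ≠ 1) (l : V →ₗ[K] K)
    (h : ∀ v, ψ (Multiplicative.ofAdd (l v)) = 1) : l = 0 := by
  by_contra hl
  obtain ⟨v, hv⟩ : ∃ v, l v ≠ 0 := by
    by_contra! h0
    exact hl (LinearMap.ext h0)
  refine hψ (MonoidHom.ext fun x => ?_)
  have := h ((x.toAdd / l v) • v)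
  rwa [map_smul, smul_eq_mul, div_mul_cancel₀ _ hv] at this

/-- Nondegeneracy makes `c ↦ ψ ∘ b c` injective, since a nonzero functional is onto `K`; a finite
abelian group has as many characters as elements, so the map is bijective. -/
theorem exists_forall_char_eq [Finite V] [Finite V'] {ψ : Multiplicative K →* ℂˣ} (hψ : ψ ≠ 1)
    (b : V' →ₗ[K] V →ₗ[K] K) (hb : ∀ c, b c = 0 → c = 0) (hcard : Nat.card V' = Nat.card V)
    (χ : Multiplicative V →* ℂˣ) :
    ∃ c, ∀ v, χ (Multiplicative.ofAdd v) = ψ (Multiplicative.ofAdd (b c v)) := by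
  let Φ : V' → (Multiplicative V →* ℂˣ) := fun c => ψ.comp (b c).toAddMonoidHom.toMultiplicative
  have hΦ : ∀ c v, Φ c (Multiplicative.ofAdd v) = ψ (Multiplicative.ofAdd (b c v)) :=
    fun _ _ => rfl
  have hinj : Function.Injective Φ := by
    intro c c' h
    rw [← sub_eq_zero]
    refine hb _ (eq_zero_of_char_eq_one hψ _ fun v => ?_)
    rw [map_sub, LinearMap.sub_apply, ofAdd_sub, map_div, ← hΦ, ← hΦ, h, div_self']
  have hfin : Finite (Multiplicative V →* ℂˣ) := by
    refine Nat.finite_of_card_ne_zero ?_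
    rw [CommGroup.card_monoidHom_of_hasEnoughRootsOfUnity]
    exact Nat.card_pos.ne'
  have hbij : Function.Bijective Φ := by
    rw [Nat.bijective_iff_injective_and_card]
    refine ⟨hinj, ?_⟩
    rw [CommGroup.card_monoidHom_of_hasEnoughRootsOfUnity, hcard]
    rfl
  obtain ⟨c, hc⟩ := hbij.2 χ
  exact ⟨c, fun v => by rw [← hc, hΦ]⟩

end FieldCharacters

/-! ### Groups of type K ⋊ Kˣ. -/

section Affine

variable {K P : Type*} [Field K] [Finite K] [Group P] [Finite P]

/-- The representation zeta function of a group of type `K ⋊ Kˣ`. -/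
theorem zeta_affine (i : Multiplicative K →* P) (κ : P →* Kˣ)
    (hi : Function.Injective i)
    (hκ : Function.Surjective κ) (hiκ : ∀ g, κ g = 1 ↔ ∃ x, i x = g)
    (hc : ∀ g x, i (Multiplicative.ofAdd (κ g * x)) = g * i (Multiplicative.ofAdd x) * g⁻¹) :
    zeta P = ((Nat.card K : ℤ[X]) - 1) * Polynomial.X + Polynomial.X ^ (Nat.card K - 1) := by
  obtain ⟨ψ, hψ⟩ := exists_char_ne_one (K := K)
  have hnormal : ∀ g x, ∃ y, i y = g * i x * g⁻¹ := fun g x => ⟨_, hc g x.toAdd⟩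
  have hψ0 : ∀ y : K, (∀ x, ψ (Multiplicative.ofAdd (y * x)) = 1) → y = 0 := fun y hy => by
    have := LinearMap.congr_fun (eq_zero_of_char_eq_one hψ (LinearMap.mul K K y) hy) 1
    simpa using this
  -- Over the trivial character of `K` lie the q-1 characters of `Kˣ`.
  let D₁ : Stabilizer i 1 Kˣ :=
    { S := ⊤
      f := κ.comp (⊤ : Subgroup P).subtype
      f_surjective := fun y => by
        obtain ⟨g, hg⟩ := hκ y
        exact ⟨⟨g, trivial⟩, hg⟩
      ext := 1
      f_eq_one_iff := fun s => hiκ s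
      ext_apply := fun _ _ _ => rfl
      injective := hi
      normal := hnormal
      mem_of_stab := fun _ _ => trivial }
  let e : Multiplicative K ≃* κ.ker := MulEquiv.ofBijective
    (i.codRestrict κ.ker fun x => (hiκ _).2 ⟨x, rfl⟩)
    ⟨fun x y h => hi (congrArg Subtype.val h), fun g => by
      obtain ⟨x, hx⟩ := (hiκ _).1 g.2
      exact ⟨x, Subtype.ext hx⟩⟩
  have he : ∀ x, (e x : P) = i x := fun _ => rfl
  -- The nontrivial characters of `K` form one orbit; the stabilizer of `ψ` is `K` itself, giving a
  -- single irreducible of dimension q-1.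
  let D₂ : Stabilizer i ψ Unit :=
    { S := κ.ker
      f := 1
      f_surjective := fun y => ⟨1, rfl⟩
      ext := ψ.comp e.symm.toMonoidHom
      f_eq_one_iff := fun s => ⟨fun _ => (hiκ _).1 s.2, fun _ => rfl⟩
      ext_apply := fun a s h => by
        have : e a = s := Subtype.ext h
        change ψ (e.symm s) = ψ a
        rw [← this, e.symm_apply_apply]
      injective := hi
      normal := hnormal
      mem_of_stab := fun g h => by
        rw [MonoidHom.mem_ker]
        have : (κ g : K) - 1 = 0 := hψ0 _ fun x => by
          rw [sub_mul, one_mul, ofAdd_sub, map_div, h _ _ (hc g x), div_self']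
        exact Units.ext (sub_eq_zero.1 this) }
  have hindex : D₂.S.index = Nat.card K - 1 := by
    rw [← Nat.card_units]
    change κ.ker.index = _
    rw [Subgroup.index_ker, MonoidHom.range_eq_top.2 hκ, Subgroup.card_top]
  have hindex₁ : D₁.S.index = 1 := Subgroup.index_top
  have hne : ∀ r : Irr P, HasWeight i 1 r.rep → ¬ HasWeight i ψ r.rep := by
    intro r h1 h2
    obtain ⟨g, hg⟩ := exists_conj_of_hasWeight r.rep_irreducible h2 h1
    refine hψ (MonoidHom.ext fun x => ?_)
    obtain ⟨y, hy⟩ := hnormal g x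
    exact (hg x y hy).symm
  rw [zeta_eq_sum_zetaOn (fun b : Bool => {r : Irr P | HasWeight i (if b then 1 else ψ) r.rep}),
    Fintype.sum_bool]
  · simp only [if_true, Bool.false_eq_true, if_false]
    rw [D₁.zetaOn_hasWeight, D₂.zetaOn_hasWeight, hindex, hindex₁, zeta_of_comm, zeta_of_comm,
      Nat.card_units, Nat.cast_sub Nat.card_pos]
    simp
  · intro r
    have := ((isIrreducible_iff _).1 r.rep_irreducible).1
    obtain ⟨χ, hχ⟩ := exists_hasWeight i r.rep
    obtain ⟨y, hy⟩ := exists_forall_char_eq hψ (LinearMap.mul K K)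
      (fun c h => by simpa using LinearMap.congr_fun h 1) rfl χ
    simp only [LinearMap.mul_apply'] at hy
    by_cases hy0 : y = 0
    · have hχ1 : χ = 1 := MonoidHom.ext fun x => by
        have := hy x.toAdd
        rwa [hy0, zero_mul, ofAdd_zero, map_one] at this
      rw [hχ1] at hχ
      refine ⟨true, hχ, fun b hb => ?_⟩
      cases b
      · exact absurd hb (hne r hχ)
      · rfl
    · have hψr : HasWeight i ψ r.rep := by
        obtain ⟨g, hg⟩ := hκ (Units.mk0 y hy0)
        refine hχ.conj g fun b => ⟨Multiplicative.ofAdd (y⁻¹ * b.toAdd), ?_, ?_⟩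
        · rw [← hc, hg, Units.val_mk0, mul_inv_cancel_left₀ hy0]
          rfl
        · rw [hy, mul_inv_cancel_left₀ hy0]
          rfl
      refine ⟨false, hψr, fun b hb => ?_⟩
      cases b
      · rfl
      · exact absurd hψr (hne r hb)

end Affine

/-! ### Semidirect products with an abelian normal factor. -/

section Semidirect

variable {A Γ : Type*} [CommGroup A] [Group Γ] (φ : Γ →* MulAut A)

theorem semidirect_conj_inl (g : A ⋊[φ] Γ) (a : A) :
    g * SemidirectProduct.inl a * g⁻¹ = SemidirectProduct.inl (φ g.right a) := by
  ext
  · simp [mul_comm]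
  · simp

variable [Finite A] [Finite Γ]

instance : Finite (A ⋊[φ] Γ) := Finite.of_equiv _ SemidirectProduct.equivProd.symm

/-- Since `St` fixes `χ`, the map `s ↦ χ s.left` is a homomorphism on `A ⋊ St`, so `χ` always
extends to its stabilizer. -/
theorem zetaOn_semidirect (χ : A →* ℂˣ) (St : Subgroup Γ)
    (hSt : ∀ g, g ∈ St ↔ ∀ a, χ (φ g a) = χ a) :
    zetaOn {r : Irr (A ⋊[φ] Γ) | HasWeight SemidirectProduct.inl χ r.rep} =
      (zeta St).comp (Polynomial.X ^ St.index) := by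
  let D : Stabilizer (SemidirectProduct.inl : A →* A ⋊[φ] Γ) χ St :=
    { S := St.comap SemidirectProduct.rightHom
      f := SemidirectProduct.rightHom.subgroupComap St
      f_surjective := MonoidHom.subgroupComap_surjective_of_surjective _ _
        SemidirectProduct.rightHom_surjective
      ext :=
        { toFun s := χ s.1.left
          map_one' := by simp
          map_mul' s t := by
            have := (hSt _).1 s.2 t.1.left
            rw [SemidirectProduct.rightHom_eq_right] at this
            simp [this] }
      f_eq_one_iff := fun s => by
        rw [Subtype.ext_iff]
        constructor
        · intro h
          exact ⟨s.1.left, SemidirectProduct.ext rfl h.symm⟩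
        · rintro ⟨a, ha⟩
          change s.1.right = 1
          rw [← ha, SemidirectProduct.right_inl]
      ext_apply := fun a s h => by
        change χ s.1.left = χ a
        rw [← h, SemidirectProduct.left_inl]
      injective := SemidirectProduct.inl_injective
      normal := fun g a => ⟨_, (semidirect_conj_inl φ g a).symm⟩
      mem_of_stab := fun g h => (hSt _).2 fun a => h a _ (semidirect_conj_inl φ g a).symm }
  rw [D.zetaOn_hasWeight]
  congr 2
  exact St.index_comap_of_surjective SemidirectProduct.rightHom_surjective

end Semidirect

theorem card_affine {K P : Type*} [Field K] [Group P] (i : Multiplicative K →* P) (κ : P →* Kˣ)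
    (hi : Function.Injective i)
    (hκ : Function.Surjective κ) (hiκ : ∀ g, κ g = 1 ↔ ∃ x, i x = g) :
    Nat.card P = Nat.card K * (Nat.card K - 1) := by
  have h1 : κ.ker = i.range := by
    ext g
    exact hiκ g
  rw [← κ.ker.card_mul_index, Subgroup.index_ker, MonoidHom.range_eq_top.2 hκ, Subgroup.card_top,
    Nat.card_units, h1, ← Nat.card_congr (MonoidHom.ofInjective hi).toEquiv]
  rfl

/-! ### The subgroups of GL₂ that occur as stabilizers. -/

section GLTwo

variable {K Γ : Type*} [Field K] [Group Γ]

/-- The unipotent matrices `!![1, x; 0, 1]`. -/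
def upperHom (K : Type*) [Field K] : Multiplicative K →* GL (Fin 2) K :=
  MonoidHom.toHomUnits
    { toFun x := !![1, x.toAdd; 0, 1]
      map_one' := by ext i j; fin_cases i <;> fin_cases j <;> simp
      map_mul' x y := by ext i j; fin_cases i <;> fin_cases j <;> simp [add_comm] }

theorem upperHom_val (x : Multiplicative K) : (upperHom K x).1 = !![1, x.toAdd; 0, 1] := rfl

/-- The unipotent matrices `!![1, 0; x, 1]`. -/
def lowerHom (K : Type*) [Field K] : Multiplicative K →* GL (Fin 2) K :=
  MonoidHom.toHomUnits
    { toFun x := !![1, 0; x.toAdd, 1]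
      map_one' := by ext i j; fin_cases i <;> fin_cases j <;> simp
      map_mul' x y := by ext i j; fin_cases i <;> fin_cases j <;> simp }

theorem lowerHom_val (x : Multiplicative K) : (lowerHom K x).1 = !![1, 0; x.toAdd, 1] := rfl

theorem GL_ext_fin_two {A B : GL (Fin 2) K} (h00 : A.1 0 0 = B.1 0 0) (h01 : A.1 0 1 = B.1 0 1)
    (h10 : A.1 1 0 = B.1 1 0) (h11 : A.1 1 1 = B.1 1 1) : A = B := by
  ext i j
  fin_cases i <;> fin_cases j <;> assumption

theorem det_val_fin_two (A : GL (Fin 2) K) :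
    (Matrix.GeneralLinearGroup.det A : K) = A.1 0 0 * A.1 1 1 - A.1 0 1 * A.1 1 0 :=
  Matrix.det_fin_two _

theorem mul_val_fin_two (A B : GL (Fin 2) K) (i j : Fin 2) :
    (A * B).1 i j = A.1 i 0 * B.1 0 j + A.1 i 1 * B.1 1 j := by
  rw [Units.val_mul, Matrix.mul_apply, Fin.sum_univ_two]

theorem zeta_card_of_unipotent [Finite Γ] (m : Γ ≃* GL (Fin 2) K) (P : Subgroup Γ)
    (hP : ∀ g, g ∈ P ↔ (m g).1 0 0 = 1 ∧ (m g).1 1 0 = 0 ∧ (m g).1 1 1 = 1) :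
    zeta P = (Nat.card K : ℤ[X]) * Polynomial.X ∧ Nat.card P = Nat.card K := by
  have hmem : ∀ x, m.symm (upperHom K x) ∈ P := fun x => by
    rw [hP, m.apply_symm_apply]
    simp [upperHom_val]
  have hcard : Nat.card P = Nat.card K := by
    refine (Nat.card_congr (Equiv.ofBijective (fun x : K =>
      (⟨_, hmem (Multiplicative.ofAdd x)⟩ : P)) ⟨fun x y h => ?_, fun g => ?_⟩)).symm
    · have h1 := m.symm.injective (congrArg Subtype.val h)
      have h2 : (upperHom K (Multiplicative.ofAdd x)).1 0 1 =
        (upperHom K (Multiplicative.ofAdd y)).1 0 1 := by rw [h1]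
      exact h2
    · refine ⟨(m g).1 0 1, Subtype.ext ?_⟩
      change m.symm _ = _
      rw [MulEquiv.symm_apply_eq]
      refine GL_ext_fin_two ?_ ?_ ?_ ?_ <;> simp [upperHom_val, (hP g).1 g.2]
  refine ⟨?_, hcard⟩
  rw [← hcard]
  refine zeta_of_forall_mul_comm fun a b => Subtype.ext (m.injective ?_)
  rw [Subgroup.coe_mul, Subgroup.coe_mul, map_mul, map_mul]
  obtain ⟨h1, h2, h3⟩ := (hP a).1 a.2
  obtain ⟨h4, h5, h6⟩ := (hP b).1 b.2
  refine GL_ext_fin_two ?_ ?_ ?_ ?_ <;> simp only [mul_val_fin_two] <;>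
    simp [h1, h2, h3, h4, h5, h6, add_comm]

variable [Finite K] [Finite Γ] (m : Γ ≃* GL (Fin 2) K)

theorem zeta_card_of_upper (P : Subgroup Γ)
    (hP : ∀ g, g ∈ P ↔ (m g).1 0 0 = 1 ∧ (m g).1 1 0 = 0) :
    zeta P = ((Nat.card K : ℤ[X]) - 1) * Polynomial.X + Polynomial.X ^ (Nat.card K - 1) ∧
      Nat.card P = Nat.card K * (Nat.card K - 1) := by
  have hmem : ∀ x, m.symm (upperHom K x) ∈ P := fun x => by
    rw [hP, m.apply_symm_apply]
    simp [upperHom_val]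
  let i : Multiplicative K →* P := (m.symm.toMonoidHom.comp (upperHom K)).codRestrict P hmem
  have hi : ∀ x, m (i x) = upperHom K x := fun x => m.apply_symm_apply _
  -- Conjugation by `!![1, b; 0, d]` sends `!![1, x; 0, 1]` to `!![1, x / d; 0, 1]`, hence the
  -- inverse; for lower triangular matrices the factor is `d` itself.
  let κ : P →* Kˣ := (Matrix.GeneralLinearGroup.det.comp (m.toMonoidHom.comp P.subtype))⁻¹
  have hκ : ∀ g : P, ((κ g)⁻¹ : Kˣ).val = (m g).1 1 1 := fun g => by
    change ((Matrix.GeneralLinearGroup.det (m g))⁻¹⁻¹ : Kˣ).val = _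
    rw [inv_inv, det_val_fin_two, ((hP g).1 g.2).1, ((hP g).1 g.2).2]
    ring
  have hinj : Function.Injective i := fun x y h => by
    have h1 : (m (i x)).1 0 1 = (m (i y)).1 0 1 := by rw [h]
    rw [hi, hi, upperHom_val, upperHom_val] at h1
    exact h1
  have hsurj : Function.Surjective κ := fun u => by
    let D : GL (Fin 2) K := Matrix.GeneralLinearGroup.mkOfDetNeZero !![1, 0; 0, (u⁻¹ : Kˣ).val]
      (by simp)
    have hD : m.symm D ∈ P := by
      rw [hP, m.apply_symm_apply]
      simp [D, Matrix.GeneralLinearGroup.mkOfDetNeZero]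
    refine ⟨⟨_, hD⟩, inv_injective (Units.ext ?_)⟩
    rw [hκ]
    change (m (m.symm D)).1 1 1 = _
    rw [m.apply_symm_apply]
    rfl
  have hker : ∀ g, κ g = 1 ↔ ∃ x, i x = g := fun g => by
    constructor
    · intro h
      have h1 := hκ g
      rw [h, inv_one, Units.val_one] at h1
      refine ⟨Multiplicative.ofAdd ((m g).1 0 1), Subtype.ext (m.injective ?_)⟩
      rw [hi]
      refine GL_ext_fin_two ?_ ?_ ?_ ?_ <;> simp [upperHom_val, (hP g).1 g.2, ← h1]
    · rintro ⟨x, rfl⟩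
      apply inv_injective
      rw [inv_one]
      apply Units.ext
      rw [hκ, hi, upperHom_val]
      simp
  refine ⟨zeta_affine i κ hinj hsurj hker fun g x => ?_, card_affine i κ hinj hsurj hker⟩
  rw [eq_mul_inv_iff_mul_eq]
  apply Subtype.ext
  apply m.injective
  rw [Subgroup.coe_mul, Subgroup.coe_mul, map_mul m, map_mul m, hi, hi]
  have h1 : (κ g : K) * (m g).1 1 1 = 1 := by rw [← hκ, ← Units.val_mul, mul_inv_cancel]; rfl
  obtain ⟨h2, h3⟩ := (hP g).1 g.2
  refine GL_ext_fin_two ?_ ?_ ?_ ?_ <;> simp only [mul_val_fin_two, upperHom_val] <;>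
    simp [h2, h3]
  linear_combination x * h1

theorem zeta_card_of_lower (P : Subgroup Γ)
    (hP : ∀ g, g ∈ P ↔ (m g).1 0 0 = 1 ∧ (m g).1 0 1 = 0) :
    zeta P = ((Nat.card K : ℤ[X]) - 1) * Polynomial.X + Polynomial.X ^ (Nat.card K - 1) ∧
      Nat.card P = Nat.card K * (Nat.card K - 1) := by
  have hmem : ∀ x, m.symm (lowerHom K x) ∈ P := fun x => by
    rw [hP, m.apply_symm_apply]
    simp [lowerHom_val]
  let i : Multiplicative K →* P := (m.symm.toMonoidHom.comp (lowerHom K)).codRestrict P hmem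
  have hi : ∀ x, m (i x) = lowerHom K x := fun x => m.apply_symm_apply _
  let κ : P →* Kˣ := Matrix.GeneralLinearGroup.det.comp (m.toMonoidHom.comp P.subtype)
  have hκ : ∀ g : P, (κ g).val = (m g).1 1 1 := fun g => by
    change (Matrix.GeneralLinearGroup.det (m g)).val = _
    rw [det_val_fin_two, ((hP g).1 g.2).1, ((hP g).1 g.2).2]
    ring
  have hinj : Function.Injective i := fun x y h => by
    have h1 : (m (i x)).1 1 0 = (m (i y)).1 1 0 := by rw [h]
    rw [hi, hi, lowerHom_val, lowerHom_val] at h1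
    exact h1
  have hsurj : Function.Surjective κ := fun u => by
    let D : GL (Fin 2) K := Matrix.GeneralLinearGroup.mkOfDetNeZero !![1, 0; 0, u.val]
      (by simp)
    have hD : m.symm D ∈ P := by
      rw [hP, m.apply_symm_apply]
      simp [D, Matrix.GeneralLinearGroup.mkOfDetNeZero]
    refine ⟨⟨_, hD⟩, Units.ext ?_⟩
    rw [hκ]
    change (m (m.symm D)).1 1 1 = _
    rw [m.apply_symm_apply]
    rfl
  have hker : ∀ g, κ g = 1 ↔ ∃ x, i x = g := fun g => by
    constructor
    · intro h
      have h1 := hκ g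
      rw [h, Units.val_one] at h1
      refine ⟨Multiplicative.ofAdd ((m g).1 1 0), Subtype.ext (m.injective ?_)⟩
      rw [hi]
      refine GL_ext_fin_two ?_ ?_ ?_ ?_ <;> simp [lowerHom_val, (hP g).1 g.2, ← h1]
    · rintro ⟨x, rfl⟩
      apply Units.ext
      rw [hκ, hi, lowerHom_val]
      simp
  refine ⟨zeta_affine i κ hinj hsurj hker fun g x => ?_, card_affine i κ hinj hsurj hker⟩
  rw [eq_mul_inv_iff_mul_eq]
  apply Subtype.ext
  apply m.injective
  rw [Subgroup.coe_mul, Subgroup.coe_mul, map_mul m, map_mul m, hi, hi]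
  obtain ⟨h2, h3⟩ := (hP g).1 g.2
  refine GL_ext_fin_two ?_ ?_ ?_ ?_ <;> simp only [mul_val_fin_two, lowerHom_val] <;>
    simp [h2, h3, hκ]
  ring

theorem zeta_card_of_diagonal (P : Subgroup Γ)
    (hP : ∀ g, g ∈ P ↔ (m g).1 0 0 = 1 ∧ (m g).1 1 0 = 0 ∧ (m g).1 0 1 = 0) :
    zeta P = ((Nat.card K : ℤ[X]) - 1) * Polynomial.X ∧ Nat.card P = Nat.card K - 1 := by
  let D : Kˣ → GL (Fin 2) K := fun u => Matrix.GeneralLinearGroup.mkOfDetNeZero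
    !![1, 0; 0, u.val] (by simp)
  have hD : ∀ u, (D u).1 = !![1, 0; 0, u.val] := fun _ => rfl
  have hmem : ∀ x, m.symm (D x) ∈ P := fun x => by
    rw [hP, m.apply_symm_apply]
    simp [hD]
  have hcard : Nat.card P = Nat.card K - 1 := by
    rw [← Nat.card_units]
    refine (Nat.card_congr (Equiv.ofBijective (fun x : Kˣ =>
      (⟨_, hmem x⟩ : P)) ⟨fun x y h => ?_, fun g => ?_⟩)).symm
    · have h1 := m.symm.injective (congrArg Subtype.val h)
      have h2 : (D x).1 1 1 = (D y).1 1 1 := by rw [h1]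
      exact Units.ext h2
    · obtain ⟨h1, h2, h3⟩ := (hP g).1 g.2
      have h4 := det_val_fin_two (m g)
      rw [h1, h2, one_mul, mul_zero, sub_zero] at h4
      refine ⟨Matrix.GeneralLinearGroup.det (m g), Subtype.ext ?_⟩
      change m.symm _ = _
      rw [MulEquiv.symm_apply_eq]
      refine GL_ext_fin_two ?_ ?_ ?_ ?_ <;> simp only [hD, h4] <;> simp [h1, h2, h3]
  refine ⟨?_, hcard⟩
  have hc1 : ((Nat.card K : ℤ[X]) - 1) = (Nat.card P : ℤ[X]) := by
    rw [hcard, Nat.cast_sub Nat.card_pos, Nat.cast_one]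
  rw [hc1]
  refine zeta_of_forall_mul_comm fun a b => Subtype.ext (m.injective ?_)
  rw [Subgroup.coe_mul, Subgroup.coe_mul, map_mul, map_mul]
  obtain ⟨h1, h2, h3⟩ := (hP a).1 a.2
  obtain ⟨h4, h5, h6⟩ := (hP b).1 b.2
  refine GL_ext_fin_two ?_ ?_ ?_ ?_ <;> simp only [mul_val_fin_two] <;>
    simp [h1, h2, h3, h4, h5, h6, mul_comm]

end GLTwo

theorem card_eq_of_equiv_GL_two {K Γ : Type*} [Field K] [Finite K] [Group Γ]
    (m : Γ ≃* GL (Fin 2) K) :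
    Nat.card Γ = (Nat.card K ^ 2 - 1) * (Nat.card K * (Nat.card K - 1)) := by
  have := Fintype.ofFinite K
  rw [Nat.card_congr m.toEquiv, Matrix.card_GL_field, Fin.prod_univ_two, Nat.card_eq_fintype_card,
    Nat.mul_sub_one, ← pow_two]
  simp


/-! ### Orbits of GL₂ on characters of K² × K². -/

section VW

variable {K : Type*} [Field K]

theorem mulVec_e1 (D : Matrix (Fin 2) (Fin 2) K) :
    Matrix.mulVec D ![1, 0] = ![1, 0] ↔ D 0 0 = 1 ∧ D 1 0 = 0 := by
  simp [funext_iff, Fin.forall_fin_two]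

theorem vecMul_e1 (D : Matrix (Fin 2) (Fin 2) K) {c : K} (hc : c ≠ 0) :
    Matrix.vecMul ![c, 0] D = ![c, 0] ↔ D 0 0 = 1 ∧ D 0 1 = 0 := by
  simp [funext_iff, Fin.forall_fin_two, Matrix.vecMul, dotProduct, Fin.sum_univ_two, hc]

theorem vecMul_e2 (D : Matrix (Fin 2) (Fin 2) K) :
    Matrix.vecMul ![0, 1] D = ![0, 1] ↔ D 1 0 = 0 ∧ D 1 1 = 1 := by
  simp [funext_iff, Fin.forall_fin_two, Matrix.vecMul, dotProduct, Fin.sum_univ_two]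

/-- The pairing `((x, ξ), (v, w)) ↦ v x + ξ w`. -/
def vwPairing (K : Type*) [Field K] : ((Fin 2 → K) × (Fin 2 → K)) →ₗ[K]
    ((Fin 2 → K) × (Fin 2 → K)) →ₗ[K] K :=
  LinearMap.mk₂ K (fun p u => dotProduct u.1 p.1 + dotProduct p.2 u.2)
    (fun p p' u => by simp only [Prod.fst_add, Prod.snd_add, dotProduct_add, add_dotProduct]; ring)
    (fun c p u => by
      simp only [Prod.smul_fst, Prod.smul_snd, dotProduct_smul, smul_dotProduct, smul_add])
    (fun p u u' => by simp only [Prod.fst_add, Prod.snd_add, dotProduct_add, add_dotProduct]; ring)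
    (fun c p u => by
      simp only [Prod.smul_fst, Prod.smul_snd, dotProduct_smul, smul_dotProduct, smul_add])

theorem vwPairing_injective (p : (Fin 2 → K) × (Fin 2 → K)) (h : vwPairing K p = 0) : p = 0 := by
  have h1 : ∀ u : (Fin 2 → K) × (Fin 2 → K), dotProduct u.1 p.1 + dotProduct p.2 u.2 = 0 :=
    fun u => LinearMap.congr_fun h u
  ext i
  · have := h1 (Pi.single i 1, 0)
    simpa using this
  · have := h1 (0, Pi.single i 1)
    simpa using this

/-- Two pairs of a column and a row vector in the same orbit of `GL₂`. -/
def VWRel (D : GL (Fin 2) K) (p p' : (Fin 2 → K) × (Fin 2 → K)) : Prop :=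
  Matrix.mulVec D.1 p'.1 = p.1 ∧ Matrix.vecMul p.2 D.1 = p'.2

theorem VWRel.trans {D D' : GL (Fin 2) K} {p p' p'' : (Fin 2 → K) × (Fin 2 → K)}
    (h : VWRel D p p') (h' : VWRel D' p' p'') : VWRel (D * D') p p'' := by
  constructor
  · rw [Units.val_mul, ← Matrix.mulVec_mulVec, h'.1, h.1]
  · rw [Units.val_mul, ← Matrix.vecMul_vecMul, h.2, h'.2]

theorem VWRel.pairing {D : GL (Fin 2) K} {p p' : (Fin 2 → K) × (Fin 2 → K)}
    (h : VWRel D p p') (u : (Fin 2 → K) × (Fin 2 → K)) :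
    vwPairing K p (vwEquiv D u) = vwPairing K p' u := by
  change dotProduct (Matrix.vecMul u.1 _) p.1 + dotProduct p.2 (Matrix.mulVec _ u.2) =
    dotProduct u.1 p'.1 + dotProduct p'.2 u.2
  rw [← h.1, ← Matrix.dotProduct_mulVec, Matrix.mulVec_mulVec, Units.inv_mul, Matrix.one_mulVec,
    Matrix.dotProduct_mulVec, h.2]

/-- Representatives of the orbits of `GL₂` on pairs of a column and a row vector. -/
def vwRepr (K : Type*) [Field K] : Kˣ ⊕ Fin 4 → (Fin 2 → K) × (Fin 2 → K)
  | Sum.inl c => (![1, 0], ![c, 0])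
  | Sum.inr 0 => (0, 0)
  | Sum.inr 1 => (![1, 0], 0)
  | Sum.inr 2 => (0, ![1, 0])
  | Sum.inr 3 => (![1, 0], ![0, 1])

/-- With the column fixed as `![1, 0]`, only matrices with this first column may be used. The first
entry of `ξ` is then invariant: if nonzero it serves to clear the second, and if zero the second can
be scaled to 1 or is 0. -/
theorem exists_vwRel_of_fst_eq (ξ : Fin 2 → K) :
    ∃ D t, VWRel D (![1, 0], ξ) (vwRepr K t) := by
  obtain ⟨a, b, rfl⟩ : ∃ a b, ξ = ![a, b] := ⟨ξ 0, ξ 1, by ext i; fin_cases i <;> rfl⟩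
  by_cases ha : a = 0
  · by_cases hb : b = 0
    · refine ⟨1, Sum.inr 1, ?_, ?_⟩
      · simp [vwRepr]
      · simp [vwRepr, ha, hb]
    · refine ⟨Matrix.GeneralLinearGroup.mkOfDetNeZero !![1, 0; 0, b⁻¹] (by simp [hb]),
        Sum.inr 3, (mulVec_e1 _).2 ?_, ?_⟩
      · simp [Matrix.GeneralLinearGroup.mkOfDetNeZero]
      · simp [vwRepr, Matrix.GeneralLinearGroup.mkOfDetNeZero, ha, hb]
  · refine ⟨Matrix.GeneralLinearGroup.mkOfDetNeZero !![1, -b / a; 0, 1] (by simp),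
      Sum.inl (Units.mk0 a ha), (mulVec_e1 _).2 ?_, ?_⟩
    · simp [Matrix.GeneralLinearGroup.mkOfDetNeZero]
    · simp [vwRepr, Matrix.GeneralLinearGroup.mkOfDetNeZero]
      field_simp
      simp

theorem exists_vwRel (p : (Fin 2 → K) × (Fin 2 → K)) : ∃ D t, VWRel D p (vwRepr K t) := by
  obtain ⟨x, ξ⟩ := p
  obtain ⟨a, b, rfl⟩ : ∃ a b, x = ![a, b] := ⟨x 0, x 1, by ext i; fin_cases i <;> rfl⟩
  by_cases ha : a = 0
  · by_cases hb : b = 0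
    · have h0 : (![a, b] : Fin 2 → K) = 0 := by ext i; fin_cases i <;> assumption
      rw [h0]
      clear h0 ha hb a b
      obtain ⟨a, b, rfl⟩ : ∃ a b, ξ = ![a, b] := ⟨ξ 0, ξ 1, by ext i; fin_cases i <;> rfl⟩
      by_cases ha : a = 0
      · by_cases hb : b = 0
        · refine ⟨1, Sum.inr 0, ?_, ?_⟩ <;> simp [vwRepr, ha, hb]
        · refine ⟨Matrix.GeneralLinearGroup.mkOfDetNeZero !![0, 1; b⁻¹, 0] (by simp [hb]),
            Sum.inr 2, ?_, ?_⟩ <;>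
          simp [vwRepr, Matrix.GeneralLinearGroup.mkOfDetNeZero, ha, hb]
      · refine ⟨Matrix.GeneralLinearGroup.mkOfDetNeZero !![a⁻¹, -b / a; 0, 1] (by simp [ha]),
          Sum.inr 2, ?_, ?_⟩
        · simp [vwRepr, Matrix.GeneralLinearGroup.mkOfDetNeZero]
        · simp [vwRepr, Matrix.GeneralLinearGroup.mkOfDetNeZero, ha]
          field_simp
          simp
    -- An invertible matrix whose first column is the given nonzero vector reduces to the case of
    -- column `![1, 0]`.
    · obtain ⟨D, t, h⟩ := exists_vwRel_of_fst_eq (Matrix.vecMul ξ !![0, 1; b, 0])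
      refine ⟨_, t, VWRel.trans (D := Matrix.GeneralLinearGroup.mkOfDetNeZero !![0, 1; b, 0]
        (by simp [hb])) ⟨?_, rfl⟩ h⟩
      ext i
      fin_cases i <;> simp [Matrix.GeneralLinearGroup.mkOfDetNeZero, Matrix.mulVec, ha]
  · obtain ⟨D, t, h⟩ := exists_vwRel_of_fst_eq (Matrix.vecMul ξ !![a, 0; b, 1])
    refine ⟨_, t, VWRel.trans (D := Matrix.GeneralLinearGroup.mkOfDetNeZero !![a, 0; b, 1]
      (by simp [ha])) ⟨?_, rfl⟩ h⟩
    ext i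
    fin_cases i <;> simp [Matrix.GeneralLinearGroup.mkOfDetNeZero, Matrix.mulVec]

/-- Three invariants separate the representatives: whether the column vanishes, whether the row
vanishes, and the scalar product of row and column. -/
theorem vwRel_repr_injective {D : GL (Fin 2) K} {t t' : Kˣ ⊕ Fin 4}
    (h : VWRel D (vwRepr K t) (vwRepr K t')) : t = t' := by
  have h1 : (vwRepr K t).1 = 0 ↔ (vwRepr K t').1 = 0 := by
    rw [← h.1]
    constructor
    · intro h0
      have := congrArg (Matrix.mulVec (D⁻¹ : GL (Fin 2) K).1) h0
      rwa [Matrix.mulVec_mulVec, Units.inv_mul, Matrix.one_mulVec, Matrix.mulVec_zero] at this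
    · intro h0
      rw [h0, Matrix.mulVec_zero]
  have h2 : (vwRepr K t).2 = 0 ↔ (vwRepr K t').2 = 0 := by
    rw [← h.2]
    constructor
    · intro h0
      rw [h0, Matrix.zero_vecMul]
    · intro h0
      have := congrArg (fun v => Matrix.vecMul v (D⁻¹ : GL (Fin 2) K).1) h0
      simpa only [Matrix.vecMul_vecMul, Units.mul_inv, Matrix.vecMul_one,
        Matrix.zero_vecMul] using this
  have h3 : dotProduct (vwRepr K t).2 (vwRepr K t).1 =
      dotProduct (vwRepr K t').2 (vwRepr K t').1 := by
    rw [← h.1, ← h.2, Matrix.dotProduct_mulVec]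
  rcases t with c | i <;> rcases t' with c' | i'
  · simp only [vwRepr, dotProduct, Fin.sum_univ_two] at h3
    simpa [Units.ext_iff] using h3
  · fin_cases i' <;> simp [vwRepr] at h1 h2 h3
  · fin_cases i <;> simp [vwRepr] at h1 h2 h3
    exact absurd h3.symm c'.ne_zero
  · fin_cases i <;> fin_cases i' <;> simp [vwRepr] at h1 h2 h3 ⊢

variable {Γ : Type*} [Group Γ]

/-- The stabilizer of a pair of a column and a row vector. -/
def vwStab (m : Γ ≃* GL (Fin 2) K) (p : (Fin 2 → K) × (Fin 2 → K)) : Subgroup Γ where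
  carrier := {g | VWRel (m g) p p}
  mul_mem' {g h} hg hh := by
    change VWRel (m (g * h)) p p
    rw [map_mul]
    exact VWRel.trans hg hh
  one_mem' := by
    change VWRel (m 1) p p
    rw [map_one]
    exact ⟨Matrix.one_mulVec _, Matrix.vecMul_one _⟩
  inv_mem' {g} hg := by
    change VWRel (m g⁻¹) p p
    rw [map_inv]
    constructor
    · conv_lhs => rw [← hg.1]
      rw [Matrix.mulVec_mulVec, Units.inv_mul, Matrix.one_mulVec]
    · conv_lhs => rw [← hg.2]
      rw [Matrix.vecMul_vecMul, Units.mul_inv, Matrix.vecMul_one]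

theorem mem_vwStab {m : Γ ≃* GL (Fin 2) K} {p : (Fin 2 → K) × (Fin 2 → K)} {g : Γ} :
    g ∈ vwStab m p ↔ Matrix.mulVec (m g).1 p.1 = p.1 ∧ Matrix.vecMul p.2 (m g).1 = p.2 := Iff.rfl

/-- The character of `K² × K²` attached to a pair of a column and a row vector. -/
def vwChar (ψ : Multiplicative K →* ℂˣ) (p : (Fin 2 → K) × (Fin 2 → K)) :
    Multiplicative ((Fin 2 → K) × (Fin 2 → K)) →* ℂˣ :=
  ψ.comp (vwPairing K p).toAddMonoidHom.toMultiplicative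

theorem vwChar_apply (ψ : Multiplicative K →* ℂˣ) (p u : (Fin 2 → K) × (Fin 2 → K)) :
    vwChar ψ p (Multiplicative.ofAdd u) = ψ (Multiplicative.ofAdd (vwPairing K p u)) := rfl

variable {m : Γ ≃* GL (Fin 2) K}
  {φ : Γ →* MulAut (Multiplicative ((Fin 2 → K) × (Fin 2 → K)))}

/-- The pulled-back character belongs to the pair (D⁻¹x, ξD), and nondegeneracy of the pairing makes
a pair recoverable from its character. -/
theorem vwChar_act_iff (hφ : ∀ g u, φ g (Multiplicative.ofAdd u) =
    Multiplicative.ofAdd (vwEquiv (m g) u)) {ψ : Multiplicative K →* ℂˣ} (hψ : ψ ≠ 1) (g : Γ)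
    (p p' : (Fin 2 → K) × (Fin 2 → K)) :
    (∀ a, vwChar ψ p (φ g a) = vwChar ψ p' a) ↔ VWRel (m g) p p' := by
  constructor
  · intro h
    have h1 : VWRel (m g) p (Matrix.mulVec ((m g)⁻¹ : GL (Fin 2) K).1 p.1,
        Matrix.vecMul p.2 (m g).1) := by
      refine ⟨?_, rfl⟩
      rw [Matrix.mulVec_mulVec, Units.mul_inv, Matrix.one_mulVec]
    suffices hp : ((Matrix.mulVec ((m g)⁻¹ : GL (Fin 2) K).1 p.1,
        Matrix.vecMul p.2 (m g).1) : (Fin 2 → K) × (Fin 2 → K)) = p' by rwa [hp] at h1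
    rw [← sub_eq_zero]
    refine vwPairing_injective _ (eq_zero_of_char_eq_one hψ _ fun u => ?_)
    have h2 := h (Multiplicative.ofAdd u)
    rw [hφ, vwChar_apply, vwChar_apply, h1.pairing] at h2
    rw [map_sub, LinearMap.sub_apply, ofAdd_sub, map_div, h2, div_self']
  · intro h u
    change vwChar ψ p (φ g (Multiplicative.ofAdd u.toAdd)) =
      vwChar ψ p' (Multiplicative.ofAdd u.toAdd)
    rw [hφ, vwChar_apply, vwChar_apply, h.pairing]

theorem index_vwStab [Finite Γ] (m : Γ ≃* GL (Fin 2) K) (p : (Fin 2 → K) × (Fin 2 → K)) {c d : ℕ}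
    (hc : Nat.card (vwStab m p) = c) (hn : Nat.card Γ = d * c) : (vwStab m p).index = d := by
  have h := (vwStab m p).card_mul_index
  rw [hn, hc, mul_comm] at h
  exact Nat.eq_of_mul_eq_mul_right (hc ▸ Nat.card_pos) h

/-- The representation zeta function of `(K² × K²) ⋊ GL₂(K)`. -/
theorem zeta_vw [Finite K] [Finite Γ] (hφ : ∀ g u, φ g (Multiplicative.ofAdd u) =
    Multiplicative.ofAdd (vwEquiv (m g) u)) :
    zeta (Multiplicative ((Fin 2 → K) × (Fin 2 → K)) ⋊[φ] Γ) =
      zeta Γ + 2 * ((Nat.card K : ℤ[X]) - 1) * Polynomial.X ^ (Nat.card K ^ 2 - 1) +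
        ((Nat.card K : ℤ[X]) - 1) ^ 2 * Polynomial.X ^ ((Nat.card K ^ 2 - 1) * Nat.card K) +
        ((Nat.card K : ℤ[X]) + 2) *
          Polynomial.X ^ ((Nat.card K ^ 2 - 1) * (Nat.card K - 1)) := by
  obtain ⟨ψ, hψ⟩ := exists_char_ne_one (K := K)
  have hcardΓ := card_eq_of_equiv_GL_two m
  have := Fintype.ofFinite Kˣ
  have hpart := fun t => zetaOn_semidirect φ (vwChar ψ (vwRepr K t)) (vwStab m (vwRepr K t))
    fun g => (vwChar_act_iff hφ hψ g _ _).symm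
  rw [zeta_eq_sum_zetaOn (fun t => {r : Irr (Multiplicative ((Fin 2 → K) × (Fin 2 → K)) ⋊[φ] Γ) |
    HasWeight SemidirectProduct.inl (vwChar ψ (vwRepr K t)) r.rep})]
  · simp only [hpart]
    have hq : (((Nat.card K - 1 : ℕ) : ℤ[X])) = (Nat.card K : ℤ[X]) - 1 := by
      rw [Nat.cast_sub Nat.card_pos, Nat.cast_one]
    have h₀ : vwStab m (vwRepr K (Sum.inr 0)) = ⊤ := by
      ext g
      simp [mem_vwStab, vwRepr]
    have h₁ := zeta_card_of_upper m (vwStab m (vwRepr K (Sum.inr 1))) fun g => by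
      simp only [mem_vwStab, vwRepr, mulVec_e1, Matrix.zero_vecMul, and_true]
    have h₂ := zeta_card_of_lower m (vwStab m (vwRepr K (Sum.inr 2))) fun g => by
      simp only [mem_vwStab, vwRepr, vecMul_e1 _ one_ne_zero, Matrix.mulVec_zero, true_and]
    have h₃ := zeta_card_of_unipotent m (vwStab m (vwRepr K (Sum.inr 3))) fun g => by
      simp only [mem_vwStab, vwRepr, mulVec_e1, vecMul_e2]
      tauto
    have h₄ := fun c => zeta_card_of_diagonal m (vwStab m (vwRepr K (Sum.inl c))) fun g => by
      simp only [mem_vwStab, vwRepr, mulVec_e1, vecMul_e1 _ c.ne_zero]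
      tauto
    -- Each of the two affine stabilizers has index q²-1 and adds (q-1) X^(q²-1) + X^((q²-1)(q-1)).
    -- The unipotent one adds q X^((q²-1)(q-1)), which explains the coefficient q+2. Each of the q-1
    -- diagonal ones adds (q-1) X^((q²-1)q).
    rw [Fintype.sum_sum_type, Fin.sum_univ_four, index_vwStab m _ h₁.2 hcardΓ,
      index_vwStab m _ h₂.2 hcardΓ,
      index_vwStab m _ h₃.2 (d := (Nat.card K ^ 2 - 1) * (Nat.card K - 1))
        (by rw [hcardΓ]; ring),
      h₁.1, h₂.1, h₃.1, h₀, Subgroup.index_top, pow_one, Polynomial.comp_X,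
      zeta_congr Subgroup.topEquiv,
      Fintype.sum_congr _ (fun _ => ((Nat.card K : ℤ[X]) - 1) *
        Polynomial.X ^ ((Nat.card K ^ 2 - 1) * Nat.card K)) fun c => ?_,
      Finset.sum_const, Finset.card_univ, ← Nat.card_eq_fintype_card, Nat.card_units,
      nsmul_eq_mul, hq]
    · simp only [Polynomial.add_comp, Polynomial.mul_comp, Polynomial.sub_comp,
        Polynomial.natCast_comp, Polynomial.one_comp, Polynomial.X_comp, Polynomial.X_pow_comp,
        ← pow_mul]
      ring
    · rw [index_vwStab m _ (h₄ c).2 (d := (Nat.card K ^ 2 - 1) * Nat.card K)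
        (by rw [hcardΓ]; ring), (h₄ c).1]
      simp
  · intro r
    have := ((isIrreducible_iff _).1 r.rep_irreducible).1
    obtain ⟨χ, hχ⟩ := exists_hasWeight (SemidirectProduct.inl :
      Multiplicative ((Fin 2 → K) × (Fin 2 → K)) →*
        Multiplicative ((Fin 2 → K) × (Fin 2 → K)) ⋊[φ] Γ) r.rep
    obtain ⟨p, hp⟩ := exists_forall_char_eq hψ (vwPairing K) vwPairing_injective rfl χ
    have hp' : χ = vwChar ψ p := MonoidHom.ext fun u => hp u.toAdd
    obtain ⟨D, t, hD⟩ := exists_vwRel p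
    have hconj : ∀ (g : Γ) a, SemidirectProduct.inl (φ g a) =
        SemidirectProduct.inr (φ := φ) g * SemidirectProduct.inl a *
          (SemidirectProduct.inr (φ := φ) g)⁻¹ := fun g a => by
      rw [semidirect_conj_inl, SemidirectProduct.right_inr]
    -- The relation for `D` describes precomposition with the action of `D`, and `HasWeight.conj` by
    -- an element precomposes with its inverse.
    refine ⟨t, hχ.conj (SemidirectProduct.inr (m.symm D)⁻¹) fun b => ?_, fun t' ht' => ?_⟩
    · refine ⟨φ (m.symm D) b, ?_, ?_⟩
      · rw [← hconj, ← MulAut.mul_apply, ← map_mul, inv_mul_cancel, map_one, MulAut.one_apply]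
      · rw [hp']
        exact ((vwChar_act_iff hφ hψ _ _ _).2 (by rwa [m.apply_symm_apply]) b).symm
    · obtain ⟨g, hg⟩ := exists_conj_of_hasWeight r.rep_irreducible hχ ht'
      have h1 : VWRel (m g.right) (vwRepr K t') p := by
        refine (vwChar_act_iff hφ hψ _ _ _).1 fun a => ?_
        rw [← hp']
        exact hg a _ (semidirect_conj_inl φ g a).symm
      exact vwRel_repr_injective (h1.trans hD)

end VW

/-! ### Block matrix groups and their irreducibles by central character. -/

/-- Coordinates on a group of block matrices `(a, b; c, D)`, where `a` is a unit of a ring `R`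
which is an extension of the field `K` by itself, `b`, `c` and `D` have entries in `K`, and the
product of a row `b` and a column `c` is taken in the ideal `K` of `R`. -/
structure BlockCoordinates (G R K : Type*) [Group G] [CommRing R] [Field K] where
  red : R →+* K
  red_surjective : Function.Surjective red
  pi : K →+ R
  pi_injective : Function.Injective pi
  -- Linearity of `pi` over `R`; with `red_eq_zero_iff` it forces the ideal `pi K` to have square
  -- zero.
  pi_red_mul : ∀ x y, pi (red x * y) = x * pi y
  red_eq_zero_iff : ∀ x, red x = 0 ↔ ∃ y, pi y = x
  a : G → R
  b : G → Fin 2 → K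
  c : G → Fin 2 → K
  D : G → Matrix (Fin 2) (Fin 2) K
  a_mul : ∀ g h, a (g * h) = a g * a h + pi (dotProduct (b g) (c h))
  b_mul : ∀ g h, b (g * h) = red (a g) • b h + Matrix.vecMul (b g) (D h)
  c_mul : ∀ g h, c (g * h) = red (a h) • c g + Matrix.mulVec (D g) (c h)
  D_mul : ∀ g h, D (g * h) = D g * D h
  ext : ∀ g h, a g = a h → b g = b h → c g = c h → D g = D h → g = h
  exists_eq : ∀ (u : Rˣ) (v w : Fin 2 → K) (E : GL (Fin 2) K),
    ∃ g, a g = u ∧ b g = v ∧ c g = w ∧ D g = E.1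

namespace BlockCoordinates

variable {G R K : Type*} [Group G] [CommRing R] [Field K] (B : BlockCoordinates G R K)

theorem red_pi (y : K) : B.red (B.pi y) = 0 := (B.red_eq_zero_iff _).2 ⟨y, rfl⟩

theorem pi_mul_pi (x y : K) : B.pi x * B.pi y = 0 := by
  rw [← B.pi_red_mul, B.red_pi, zero_mul, map_zero]

/-- The embedding of `K` into the units of `R` as `1 + π K`. -/
def oneAddPi : Multiplicative K →* Rˣ :=
  MonoidHom.toHomUnits
    { toFun x := 1 + B.pi x.toAdd
      map_one' := by simp
      map_mul' x y := by
        rw [toAdd_mul, map_add]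
        linear_combination -B.pi_mul_pi x.toAdd y.toAdd }

theorem oneAddPi_val (x : Multiplicative K) : (B.oneAddPi x : R) = 1 + B.pi x.toAdd := rfl

/-- Reduction of units. -/
abbrev redUnits : Rˣ →* Kˣ := Units.map B.red.toMonoidHom

theorem redUnits_val (u : Rˣ) : (B.redUnits u : K) = B.red u := rfl

theorem oneAddPi_injective : Function.Injective B.oneAddPi := fun x y h => by
  have h1 := congrArg Units.val h
  rw [oneAddPi_val, oneAddPi_val] at h1
  exact B.pi_injective (add_left_cancel h1)

theorem redUnits_eq_one_iff (u : Rˣ) : B.redUnits u = 1 ↔ ∃ x, B.oneAddPi x = u := by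
  constructor
  · intro h
    have h1 : B.red (u - 1 : R) = 0 := by
      rw [map_sub, map_one, ← B.redUnits_val, h, Units.val_one, sub_self]
    obtain ⟨y, hy⟩ := (B.red_eq_zero_iff _).1 h1
    refine ⟨Multiplicative.ofAdd y, Units.ext ?_⟩
    rw [oneAddPi_val, toAdd_ofAdd, hy, add_sub_cancel]
  · rintro ⟨x, rfl⟩
    apply Units.ext
    rw [B.redUnits_val, B.oneAddPi_val, map_add, map_one, B.red_pi, add_zero, Units.val_one]

theorem isUnit_of_red_ne_zero {x : R} (hx : B.red x ≠ 0) : IsUnit x := by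
  obtain ⟨y, hy⟩ := B.red_surjective (B.red x)⁻¹
  have h1 : B.red (x * y - 1) = 0 := by
    rw [map_sub, map_mul, hy, mul_inv_cancel₀ hx, map_one, sub_self]
  obtain ⟨z, hz⟩ := (B.red_eq_zero_iff _).1 h1
  have h2 : IsUnit (x * y) := by
    have : x * y = B.oneAddPi (Multiplicative.ofAdd z) := by
      rw [oneAddPi_val, toAdd_ofAdd, hz, add_sub_cancel]
    rw [this]
    exact Units.isUnit _
  exact isUnit_of_mul_isUnit_left h2

theorem redUnits_surjective : Function.Surjective B.redUnits := fun y => by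
  obtain ⟨x, hx⟩ := B.red_surjective y
  obtain ⟨u, rfl⟩ := B.isUnit_of_red_ne_zero (x := x) (by rw [hx]; exact y.ne_zero)
  exact ⟨u, Units.ext hx⟩

theorem card_units (B : BlockCoordinates G R K) : Nat.card Rˣ = Nat.card K * (Nat.card K - 1) :=
  card_affine B.oneAddPi B.redUnits B.oneAddPi_injective B.redUnits_surjective
    B.redUnits_eq_one_iff

/-- The element with given coordinates. -/
def elt (u : Rˣ) (v w : Fin 2 → K) (E : GL (Fin 2) K) : G := (B.exists_eq u v w E).choose

section Elt

variable (u : Rˣ) (v w : Fin 2 → K) (E : GL (Fin 2) K)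

@[simp] theorem a_elt : B.a (B.elt u v w E) = u := (B.exists_eq u v w E).choose_spec.1
@[simp] theorem b_elt : B.b (B.elt u v w E) = v := (B.exists_eq u v w E).choose_spec.2.1
@[simp] theorem c_elt : B.c (B.elt u v w E) = w := (B.exists_eq u v w E).choose_spec.2.2.1
@[simp] theorem D_elt : B.D (B.elt u v w E) = E.1 := (B.exists_eq u v w E).choose_spec.2.2.2

end Elt

/-- The product rules make this element idempotent, so the coordinates of the identity need not be
assumed. -/
theorem elt_one : B.elt 1 0 0 1 = 1 := by
  have h : B.elt 1 0 0 1 * B.elt 1 0 0 1 = B.elt 1 0 0 1 := by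
    apply B.ext <;> simp [B.a_mul, B.b_mul, B.c_mul, B.D_mul]
  exact mul_eq_left.1 h

theorem a_one : B.a 1 = 1 := by rw [← B.elt_one, B.a_elt, Units.val_one]
theorem b_one : B.b 1 = 0 := by rw [← B.elt_one, B.b_elt]
theorem c_one : B.c 1 = 0 := by rw [← B.elt_one, B.c_elt]
theorem D_one : B.D 1 = 1 := by rw [← B.elt_one, B.D_elt, Units.val_one]

/-- The reduction of the upper left corner. -/
def corner : G →* Kˣ :=
  MonoidHom.toHomUnits
    { toFun g := B.red (B.a g)
      map_one' := by rw [B.a_one, map_one]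
      map_mul' g h := by rw [B.a_mul, map_add, B.red_pi, add_zero, map_mul] }

theorem corner_val (g : G) : (B.corner g : K) = B.red (B.a g) := rfl

theorem isUnit_a (g : G) : IsUnit (B.a g) :=
  B.isUnit_of_red_ne_zero (by rw [← B.corner_val]; exact Units.ne_zero _)

/-- The lower right block. -/
def block : G →* GL (Fin 2) K :=
  MonoidHom.toHomUnits
    { toFun := B.D
      map_one' := B.D_one
      map_mul' := B.D_mul }

theorem block_val (g : G) : (B.block g).1 = B.D g := rfl

theorem corner_elt (u : Rˣ) (v w : Fin 2 → K) (E : GL (Fin 2) K) :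
    B.corner (B.elt u v w E) = B.redUnits u :=
  Units.ext (by rw [corner_val, a_elt, redUnits_val])

theorem block_elt (u : Rˣ) (v w : Fin 2 → K) (E : GL (Fin 2) K) :
    B.block (B.elt u v w E) = E :=
  Units.ext (by rw [block_val, D_elt])

end BlockCoordinates

/-- Scalar matrices. -/
def scalarGL (K : Type*) [Field K] : Kˣ →* GL (Fin 2) K :=
  Units.map (algebraMap K (Matrix (Fin 2) (Fin 2) K)).toMonoidHom

section scalarGL

variable {K : Type*} [Field K]

theorem scalarGL_val (u : Kˣ) : (scalarGL K u).1 = (u : K) • (1 : Matrix (Fin 2) (Fin 2) K) :=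
  Algebra.algebraMap_eq_smul_one _

theorem scalarGL_comm (u : Kˣ) (E : GL (Fin 2) K) : scalarGL K u * E = E * scalarGL K u := by
  apply Units.ext
  rw [Units.val_mul, Units.val_mul, scalarGL_val, Matrix.smul_mul, Matrix.mul_smul,
    Matrix.one_mul, Matrix.mul_one]

end scalarGL

namespace BlockCoordinates

variable {G R K : Type*} [Group G] [CommRing R] [Field K] (B : BlockCoordinates G R K)

/-- The normalized lower right block. -/
def normBlock : G →* GL (Fin 2) K where
  toFun g := scalarGL K (B.corner g)⁻¹ * B.block g
  map_one' := by rw [map_one, map_one, inv_one, map_one, one_mul]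
  map_mul' g h := by
    rw [map_mul, map_mul, mul_inv, map_mul]
    exact Commute.mul_mul_mul_comm (scalarGL_comm _ _) _ _

theorem normBlock_val (g : G) : (B.normBlock g).1 = ((B.corner g)⁻¹ : Kˣ).val • B.D g := by
  change (scalarGL K (B.corner g)⁻¹).1 * B.D g = _
  rw [scalarGL_val, Matrix.smul_mul, Matrix.one_mul]

theorem D_eq_of_normBlock_eq_one {g : G} (h : B.normBlock g = 1) :
    B.D g = B.red (B.a g) • (1 : Matrix (Fin 2) (Fin 2) K) := by
  have h1 := B.normBlock_val g
  rw [h, Units.val_one] at h1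
  rw [h1, smul_smul, ← B.corner_val, ← Units.val_mul, mul_inv_cancel, Units.val_one, one_smul]

/-- The elements `(u, u β; 0, u)`. -/
def borel : Rˣ × Multiplicative (Fin 2 → K) →* G where
  toFun x := B.elt x.1 (B.red x.1 • x.2.toAdd) 0 (scalarGL K (B.redUnits x.1))
  map_one' := by
    rw [Prod.fst_one, Prod.snd_one, toAdd_one, smul_zero, map_one, map_one, B.elt_one]
  map_mul' x y := by
    apply B.ext
    · simp [B.a_mul]
    · simp only [B.b_mul, b_elt, a_elt, D_elt, scalarGL_val, Prod.fst_mul, Prod.snd_mul, toAdd_mul,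
        Units.val_mul, map_mul, Matrix.vecMul_smul, Matrix.vecMul_one, redUnits_val, smul_add,
        smul_smul]
      rw [mul_comm (B.red y.1.val), add_comm]
    · simp [B.c_mul]
    · simp [B.D_mul, scalarGL_val, smul_smul]

theorem borel_apply (x : Rˣ × Multiplicative (Fin 2 → K)) :
    B.borel x = B.elt x.1 (B.red x.1 • x.2.toAdd) 0 (scalarGL K (B.redUnits x.1)) := rfl

theorem borel_injective : Function.Injective B.borel := fun x y h => by
  rw [borel_apply, borel_apply] at h
  have h1 := congrArg B.a h
  have h2 := congrArg B.b h
  rw [a_elt, a_elt] at h1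
  rw [b_elt, b_elt, h1] at h2
  have h3 : B.red y.1 ≠ 0 := by rw [← B.redUnits_val]; exact Units.ne_zero _
  exact Prod.ext (Units.ext h1) (smul_right_injective (Fin 2 → K) h3 h2)

/-- The whole argument for nontrivial ω rests on this formula: the lower left block `c` of `g`
shifts the unit by an element of 1 + πK that is linear in `β`. The leftover quadratic term vanishes
because π² = 0. -/
theorem conj_borel (g : G) (u : Rˣ) (β : Fin 2 → K) :
    B.borel (u * B.oneAddPi (Multiplicative.ofAdd
      (-dotProduct (Matrix.vecMul β ((B.block g)⁻¹ : GL (Fin 2) K).1) (B.c g))),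
      Multiplicative.ofAdd (B.red (B.a g) • Matrix.vecMul β ((B.block g)⁻¹ : GL (Fin 2) K).1)) =
    g * B.borel (u, Multiplicative.ofAdd β) * g⁻¹ := by
  rw [eq_mul_inv_iff_mul_eq]
  have hD : Matrix.vecMul (Matrix.vecMul β ((B.block g)⁻¹ : GL (Fin 2) K).1) (B.D g) = β := by
    rw [← B.block_val, Matrix.vecMul_vecMul, Units.inv_mul, Matrix.vecMul_one]
  have hred : ∀ x : K, B.redUnits (B.oneAddPi (Multiplicative.ofAdd x)) = 1 := fun x =>
    (B.redUnits_eq_one_iff _).2 ⟨_, rfl⟩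
  have hred' : ∀ x : K, B.red (B.oneAddPi (Multiplicative.ofAdd x)) = 1 := fun x => by
    rw [← B.redUnits_val, hred, Units.val_one]
  generalize Matrix.vecMul β ((B.block g)⁻¹ : GL (Fin 2) K).1 = γ at hD ⊢
  subst hD
  simp only [borel_apply]
  apply B.ext
  · rw [B.a_mul, B.a_mul, a_elt, a_elt, b_elt, c_elt, Units.val_mul, dotProduct_zero, map_zero,
      add_zero, oneAddPi_val, toAdd_ofAdd, toAdd_ofAdd, smul_smul, smul_dotProduct, smul_eq_mul,
      ← map_mul, B.pi_red_mul, map_neg]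
    have := B.pi_mul_pi (dotProduct γ (B.c g)) (dotProduct γ (B.c g))
    linear_combination -(u : R) * B.a g * this
  · rw [B.b_mul, B.b_mul, a_elt, b_elt, b_elt, D_elt, Units.val_mul, map_mul, hred', mul_one,
      scalarGL_val, Matrix.vecMul_smul, Matrix.vecMul_one, toAdd_ofAdd, toAdd_ofAdd,
      Matrix.smul_vecMul, Matrix.smul_vecMul, redUnits_val, add_comm, smul_smul, smul_smul,
      mul_comm]
  · rw [B.c_mul, B.c_mul, a_elt, c_elt, c_elt, D_elt, map_mul, hred, mul_one, scalarGL_val,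
      Matrix.smul_mulVec, Matrix.one_mulVec, smul_zero, zero_add, Matrix.mulVec_zero, add_zero,
      redUnits_val]
  · rw [B.D_mul, B.D_mul, D_elt, D_elt, map_mul, hred, mul_one, scalarGL_val, Matrix.smul_mul,
      Matrix.one_mul, Matrix.mul_smul, Matrix.mul_one]

/-- The scalar elements. -/
def scalars : Rˣ →* G := B.borel.comp (MonoidHom.inl _ _)

theorem scalars_apply (u : Rˣ) : B.scalars u = B.borel (u, Multiplicative.ofAdd 0) := rfl

theorem scalars_injective : Function.Injective B.scalars :=
  B.borel_injective.comp fun _ _ h => (Prod.ext_iff.1 h).1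

theorem conj_scalars (g : G) (u : Rˣ) : B.scalars u = g * B.scalars u * g⁻¹ := by
  rw [scalars_apply, ← conj_borel, Matrix.zero_vecMul, zero_dotProduct, neg_zero, smul_zero,
    ofAdd_zero, ofAdd_zero, map_one, mul_one]

section TrivialOnPi

variable {Γ : Type*} [Group Γ] {m : Γ ≃* GL (Fin 2) K}
  {φ : Γ →* MulAut (Multiplicative ((Fin 2 → K) × (Fin 2 → K)))}

/-- The quotient by the scalars. -/
def toSemidirect (hφ : ∀ g u, φ g (Multiplicative.ofAdd u) =
    Multiplicative.ofAdd (vwEquiv (m g) u)) :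
    G →* Multiplicative ((Fin 2 → K) × (Fin 2 → K)) ⋊[φ] Γ where
  toFun g := ⟨Multiplicative.ofAdd (Matrix.vecMul (B.b g) ((B.block g)⁻¹ : GL (Fin 2) K).1,
    ((B.corner g)⁻¹ : Kˣ).val • B.c g), m.symm (B.normBlock g)⟩
  map_one' := by
    refine SemidirectProduct.ext ?_ ?_
    · simp only [B.b_one, B.c_one, Matrix.zero_vecMul, smul_zero]
      rfl
    · simp only [map_one]
      rfl
  map_mul' g h := by
    refine SemidirectProduct.ext ?_ ?_
    · rw [SemidirectProduct.mul_left, hφ, ← ofAdd_add, m.apply_symm_apply]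
      refine congrArg Multiplicative.ofAdd (Prod.ext ?_ ?_)
      · change Matrix.vecMul (B.b (g * h)) ((B.block (g * h))⁻¹ : GL (Fin 2) K).1 =
          Matrix.vecMul (B.b g) ((B.block g)⁻¹ : GL (Fin 2) K).1 +
          Matrix.vecMul (Matrix.vecMul (B.b h) ((B.block h)⁻¹ : GL (Fin 2) K).1)
            ((B.normBlock g)⁻¹ : GL (Fin 2) K).1
        have h1 : ((B.normBlock g)⁻¹ : GL (Fin 2) K) =
            (B.block g)⁻¹ * scalarGL K (B.corner g) := by
          change (scalarGL K (B.corner g)⁻¹ * B.block g)⁻¹ = _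
          rw [mul_inv_rev, map_inv, inv_inv]
        rw [B.b_mul, h1, map_mul, mul_inv_rev, Matrix.add_vecMul, Units.val_mul, Units.val_mul,
          ← Matrix.vecMul_vecMul, ← Matrix.vecMul_vecMul, ← Matrix.vecMul_vecMul, scalarGL_val,
          Matrix.vecMul_smul, Matrix.vecMul_one, Matrix.smul_vecMul, Matrix.smul_vecMul,
          ← B.block_val h, Matrix.vecMul_vecMul _ (B.block h).1, Units.mul_inv,
          Matrix.vecMul_one, add_comm, corner_val]
      · change ((B.corner (g * h))⁻¹ : Kˣ).val • B.c (g * h) =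
          ((B.corner g)⁻¹ : Kˣ).val • B.c g +
            Matrix.mulVec (B.normBlock g).1 (((B.corner h)⁻¹ : Kˣ).val • B.c h)
        rw [B.c_mul, B.normBlock_val, Matrix.smul_mulVec, Matrix.mulVec_smul, smul_add, smul_smul,
          smul_smul, ← B.corner_val, map_mul, mul_inv, ← Units.val_mul, ← Units.val_mul,
          inv_mul_cancel_right]
    · rw [SemidirectProduct.mul_right]
      simp only [map_mul]

theorem toSemidirect_surjective (hφ : ∀ g u, φ g (Multiplicative.ofAdd u) =
    Multiplicative.ofAdd (vwEquiv (m g) u)) : Function.Surjective (B.toSemidirect hφ) := fun x => by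
  refine ⟨B.elt 1 (Matrix.vecMul x.left.toAdd.1 (m x.right).1) x.left.toAdd.2 (m x.right),
    SemidirectProduct.ext ?_ ?_⟩
  · change Multiplicative.ofAdd (Matrix.vecMul (B.b (B.elt _ _ _ _)) _, _ • B.c _) = x.left
    rw [b_elt, c_elt, B.block_elt, B.corner_elt, Matrix.vecMul_vecMul, Units.mul_inv,
      Matrix.vecMul_one, map_one, inv_one, Units.val_one, one_smul]
    rfl
  · change m.symm (B.normBlock _) = x.right
    rw [MulEquiv.symm_apply_eq]
    apply Units.ext
    rw [normBlock_val, D_elt, B.corner_elt, map_one, inv_one, Units.val_one, one_smul]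

/-- A central character factoring through `redUnits` extends to all of `G` by way of `corner`, so `S
= ⊤` and dimensions are unchanged; the quotient by the scalars is `toSemidirect`. -/
theorem zetaOn_scalars_of_trivial [Finite G] [Finite R] [Finite K] [Finite Γ]
    (hφ : ∀ g u, φ g (Multiplicative.ofAdd u) =
    Multiplicative.ofAdd (vwEquiv (m g) u)) (ω : Kˣ →* ℂˣ) :
    zetaOn {r : Irr G | HasWeight B.scalars (ω.comp B.redUnits) r.rep} =
      zeta (Multiplicative ((Fin 2 → K) × (Fin 2 → K)) ⋊[φ] Γ) := by
  let S : Stabilizer B.scalars (ω.comp B.redUnits)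
      (Multiplicative ((Fin 2 → K) × (Fin 2 → K)) ⋊[φ] Γ) :=
    { S := ⊤
      f := (B.toSemidirect hφ).comp (⊤ : Subgroup G).subtype
      f_surjective := fun x => by
        obtain ⟨g, hg⟩ := B.toSemidirect_surjective hφ x
        exact ⟨⟨g, trivial⟩, hg⟩
      ext := (ω.comp B.corner).comp (⊤ : Subgroup G).subtype
      f_eq_one_iff := fun s => by
        constructor
        · intro h
          have h1 : Matrix.vecMul (B.b s) ((B.block s)⁻¹ : GL (Fin 2) K).1 = 0 :=
            congrArg (fun x => x.left.toAdd.1) h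
          have h2 : ((B.corner s)⁻¹ : Kˣ).val • B.c s = 0 :=
            congrArg (fun x => x.left.toAdd.2) h
          have h3 : m.symm (B.normBlock s) = 1 := congrArg (fun x => x.right) h
          refine ⟨(B.isUnit_a s).unit, B.ext _ _ ?_ ?_ ?_ ?_⟩
          · rw [scalars_apply, borel_apply, a_elt, IsUnit.unit_spec]
          · rw [scalars_apply, borel_apply, b_elt, toAdd_ofAdd, smul_zero]
            have h4 := congrArg (fun v => Matrix.vecMul v (B.block s).1) h1
            simpa only [Matrix.vecMul_vecMul, Units.inv_mul, Matrix.vecMul_one,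
              Matrix.zero_vecMul] using h4.symm
          · rw [scalars_apply, borel_apply, c_elt]
            exact ((smul_eq_zero.1 h2).resolve_left (Units.ne_zero _)).symm
          · rw [scalars_apply, borel_apply, D_elt, scalarGL_val, redUnits_val, IsUnit.unit_spec,
              B.D_eq_of_normBlock_eq_one ((map_eq_one_iff _ m.symm.injective).1 h3)]
        · rintro ⟨u, hu⟩
          have h1 : B.normBlock s = 1 := by
            apply Units.ext
            rw [normBlock_val, ← hu, scalars_apply, borel_apply, D_elt, B.corner_elt, scalarGL_val,
              smul_smul, ← Units.val_mul, inv_mul_cancel, Units.val_one, one_smul, Units.val_one]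
          refine SemidirectProduct.ext ?_ ?_
          · change Multiplicative.ofAdd (Matrix.vecMul (B.b s) _, _ • B.c s) = 1
            rw [← hu, scalars_apply, borel_apply, b_elt, c_elt, toAdd_ofAdd, smul_zero, smul_zero,
              Matrix.zero_vecMul]
            rfl
          · change m.symm (B.normBlock s) = 1
            rw [h1, map_one]
      ext_apply := fun u s h => by
        change ω (B.corner s) = ω (B.redUnits u)
        rw [← h, scalars_apply, borel_apply, B.corner_elt]
      injective := B.scalars_injective
      normal := fun g a => ⟨a, B.conj_scalars g a⟩
      mem_of_stab := fun _ _ => trivial }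
  have h : S.S.index = 1 := Subgroup.index_top
  rw [S.zetaOn_hasWeight, h, pow_one, Polynomial.comp_X]

end TrivialOnPi

/-- The elements with vanishing lower left corner. -/
def parabolic : Subgroup G where
  carrier := {g | B.c g = 0}
  mul_mem' {g h} hg hh := by
    change B.c (g * h) = 0
    rw [B.c_mul, hg, hh, smul_zero, Matrix.mulVec_zero, add_zero]
  one_mem' := B.c_one
  inv_mem' {g} hg := by
    have h1 := B.c_mul g g⁻¹
    rw [mul_inv_cancel, B.c_one, hg, smul_zero, zero_add] at h1
    have h2 := congrArg (Matrix.mulVec ((B.block g)⁻¹ : GL (Fin 2) K).1) h1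
    rw [← B.block_val, Matrix.mulVec_mulVec, Units.inv_mul, Matrix.one_mulVec,
      Matrix.mulVec_zero] at h2
    exact h2.symm

theorem mem_parabolic {g : G} : g ∈ B.parabolic ↔ B.c g = 0 := Iff.rfl

theorem index_parabolic [Finite K] : B.parabolic.index = Nat.card K ^ 2 := by
  -- Left cosets are classified by the first column scaled to have corner 1 mod π, that is, by a
  -- vector of K².
  have hiff : ∀ g h, g⁻¹ * h ∈ B.parabolic ↔
      ((B.corner g)⁻¹ : Kˣ).val • B.c g = ((B.corner h)⁻¹ : Kˣ).val • B.c h := by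
    intro g h
    obtain ⟨k, rfl⟩ : ∃ k, h = g * k := ⟨g⁻¹ * h, by group⟩
    rw [inv_mul_cancel_left, mem_parabolic, B.c_mul, smul_add, smul_smul, ← B.corner_val, map_mul,
      mul_inv, ← Units.val_mul, inv_mul_cancel_right, left_eq_add, smul_eq_zero,
      or_iff_right (Units.ne_zero _), ← B.block_val]
    constructor
    · intro h
      rw [h, Matrix.mulVec_zero]
    · intro h
      have h2 := congrArg (Matrix.mulVec ((B.block g)⁻¹ : GL (Fin 2) K).1) h
      rwa [Matrix.mulVec_mulVec, Units.inv_mul, Matrix.one_mulVec, Matrix.mulVec_zero] at h2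
  have e : G ⧸ B.parabolic ≃ (Fin 2 → K) := Equiv.ofBijective
    (Quotient.lift (fun g => ((B.corner g)⁻¹ : Kˣ).val • B.c g) fun g h hgh =>
      (hiff g h).1 (QuotientGroup.leftRel_apply.1 hgh))
    ⟨fun x y => by
      induction x using Quotient.inductionOn
      induction y using Quotient.inductionOn
      exact fun h => Quotient.sound (QuotientGroup.leftRel_apply.2 ((hiff _ _).2 h)),
    fun w => ⟨⟦B.elt 1 0 w 1⟧, by
      change ((B.corner (B.elt 1 0 w 1))⁻¹ : Kˣ).val • B.c (B.elt 1 0 w 1) = w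
      rw [B.corner_elt, c_elt, map_one, inv_one, Units.val_one, one_smul]⟩⟩
  rw [Subgroup.index, Nat.card_congr e, Nat.card_fun, Nat.card_fin]

/-- On the elements with `c = 0` the corner `a` is multiplicative, so ω(a) extends the character;
`normBlock` maps this subgroup onto GL₂ with kernel `borel`. -/
theorem zetaOn_borel [Finite G] [Finite R] [Finite K] {ω : Rˣ →* ℂˣ}
    (hω : ω.comp B.oneAddPi ≠ 1) :
    zetaOn {r : Irr G | HasWeight B.borel (ω.comp (MonoidHom.fst _ _)) r.rep} =
      (zeta (GL (Fin 2) K)).comp (Polynomial.X ^ Nat.card K ^ 2) := by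
  let S : Stabilizer B.borel (ω.comp (MonoidHom.fst _ _)) (GL (Fin 2) K) :=
    { S := B.parabolic
      f := B.normBlock.comp B.parabolic.subtype
      f_surjective := fun E => by
        refine ⟨⟨B.elt 1 0 0 E, B.c_elt _ _ _ _⟩, Units.ext ?_⟩
        change (B.normBlock (B.elt 1 0 0 E)).1 = E.1
        rw [normBlock_val, D_elt, B.corner_elt, map_one, inv_one, Units.val_one, one_smul]
      ext := ω.comp (MonoidHom.toHomUnits
        { toFun := fun s : B.parabolic => B.a s
          map_one' := B.a_one
          map_mul' := fun s t => by
            rw [Subgroup.coe_mul, B.a_mul, t.2, dotProduct_zero, map_zero, add_zero] })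
      f_eq_one_iff := fun s => by
        constructor
        · intro h
          refine ⟨((B.isUnit_a s).unit,
            Multiplicative.ofAdd (((B.corner s)⁻¹ : Kˣ).val • B.b s)), B.ext _ _ ?_ ?_ ?_ ?_⟩
          · rw [borel_apply, a_elt, IsUnit.unit_spec]
          · rw [borel_apply, b_elt, toAdd_ofAdd, IsUnit.unit_spec, ← B.corner_val, smul_smul,
              ← Units.val_mul, mul_inv_cancel, Units.val_one, one_smul]
          · rw [borel_apply, c_elt, s.2]
          · rw [borel_apply, D_elt, scalarGL_val, redUnits_val, IsUnit.unit_spec,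
              B.D_eq_of_normBlock_eq_one (g := (s : G)) h]
        · rintro ⟨u, hu⟩
          apply Units.ext
          change (B.normBlock s).1 = 1
          rw [normBlock_val, ← hu, borel_apply, D_elt, B.corner_elt, scalarGL_val,
            smul_smul, ← Units.val_mul, inv_mul_cancel, Units.val_one, one_smul]
      ext_apply := fun u s h => by
        refine congrArg ω (Units.ext ?_)
        change B.a s = u.1
        rw [← h, borel_apply, a_elt]
      injective := B.borel_injective
      normal := fun g x => ⟨_, B.conj_borel g x.1 x.2.toAdd⟩
      mem_of_stab := fun g h => by
        have hl := eq_zero_of_char_eq_one hω ((dotProductBilin K K).flip (B.c g)) fun γ => ?_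
        · rw [mem_parabolic]
          ext i
          have := LinearMap.congr_fun hl (Pi.single i 1)
          simpa using this
        -- With β = -γD the shift of the unit is 1 + π(γc), so ω being fixed means that it is
        -- trivial there for all γ; this forces c = 0.
        · have h1 := h _ _ (B.conj_borel g 1 (Matrix.vecMul (-γ) (B.block g).1)).symm.symm
          rw [Matrix.vecMul_vecMul, Units.mul_inv, Matrix.vecMul_one, neg_dotProduct, neg_neg,
            one_mul] at h1
          exact h1.trans (map_one ω) }
  have h : S.S.index = Nat.card K ^ 2 := B.index_parabolic
  rw [S.zetaOn_hasWeight, h]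

theorem exists_hasWeight_scalars [Finite R] (r : Irr G) :
    ∃! ω, HasWeight B.scalars ω r.rep := by
  have := ((isIrreducible_iff _).1 r.rep_irreducible).1
  obtain ⟨ω, hω⟩ := exists_hasWeight B.scalars r.rep
  refine ⟨ω, hω, fun ω' hω' => ?_⟩
  obtain ⟨g, hg⟩ := exists_conj_of_hasWeight r.rep_irreducible hω hω'
  exact MonoidHom.ext fun u => hg u u (B.conj_scalars g u)

/-- An extension of ω to `borel` has the form (u, β) ↦ ω(u) ω(1 + π(xβ)), by duality for the
nontrivial character of K given by ω. Conjugation by (1, 0; -x, 1) removes the second factor. -/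
theorem hasWeight_borel_iff [Finite R] [Finite K] {ω : Rˣ →* ℂˣ} (hω : ω.comp B.oneAddPi ≠ 1)
    (r : Irr G) : HasWeight B.borel (ω.comp (MonoidHom.fst _ _)) r.rep ↔
      HasWeight B.scalars ω r.rep := by
  have hres : ∀ χ, HasWeight B.borel χ r.rep →
      HasWeight B.scalars (χ.comp (MonoidHom.inl _ _)) r.rep := by
    rintro χ ⟨v, hv, hw⟩
    exact ⟨v, hv, fun u => hw (u, 1)⟩
  constructor
  · exact hres _
  · intro h
    have := ((isIrreducible_iff _).1 r.rep_irreducible).1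
    obtain ⟨χ, hχ⟩ := exists_hasWeight B.borel r.rep
    have h1 := (B.exists_hasWeight_scalars r).unique (hres χ hχ) h
    have hψ : ∃ x, ∀ β, (χ.comp (MonoidHom.inr _ _)) (Multiplicative.ofAdd β) =
        ω.comp B.oneAddPi (Multiplicative.ofAdd (dotProductBilin K K x β)) :=
      exists_forall_char_eq hω _ (fun x hx => funext fun i => by
        simpa using LinearMap.congr_fun hx (Pi.single i 1)) rfl _
    obtain ⟨x, hx⟩ := hψ
    have hχ' : ∀ u β, χ (u, Multiplicative.ofAdd β) =
        ω u * ω (B.oneAddPi (Multiplicative.ofAdd (dotProduct x β))) := fun u β => by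
      have h2 : χ (1, Multiplicative.ofAdd β) =
        ω (B.oneAddPi (Multiplicative.ofAdd (dotProduct x β))) := hx β
      have h3 : χ (u, 1) = ω u := DFunLike.congr_fun h1 u
      rw [← h2, ← h3, ← map_mul, Prod.mk_mul_mk, mul_one, one_mul]
    refine hχ.conj (B.elt 1 0 (-x) 1) fun u => ⟨(u.1 * B.oneAddPi (Multiplicative.ofAdd
      (-dotProduct x u.2.toAdd)), Multiplicative.ofAdd u.2.toAdd), ?_, ?_⟩
    · rw [← conj_borel, B.block_elt, a_elt, c_elt, inv_one, Units.val_one, Matrix.vecMul_one,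
        Units.val_one, map_one, one_smul, dotProduct_neg, neg_neg, mul_assoc, ← map_mul,
        dotProduct_comm x, ofAdd_neg, inv_mul_cancel, map_one, mul_one]
      rfl
    · rw [hχ', map_mul, mul_assoc, ← map_mul ω, ofAdd_neg, map_inv, inv_mul_cancel, map_one,
        mul_one]
      rfl

/-- The representation zeta function of a group with block coordinates. -/
theorem zeta_eq (B : BlockCoordinates G R K) [Finite G] [Finite R] [Finite K]
    {Γ : Type*} [Group Γ] [Finite Γ]
    {m : Γ ≃* GL (Fin 2) K} {φ : Γ →* MulAut (Multiplicative ((Fin 2 → K) × (Fin 2 → K)))}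
    (hφ : ∀ g u, φ g (Multiplicative.ofAdd u) = Multiplicative.ofAdd (vwEquiv (m g) u)) :
    zeta G = ((Nat.card K : ℤ[X]) - 1) ^ 2 *
        (zeta (GL (Fin 2) K)).comp (Polynomial.X ^ Nat.card K ^ 2) +
      ((Nat.card K : ℤ[X]) - 1) *
        zeta (Multiplicative ((Fin 2 → K) × (Fin 2 → K)) ⋊[φ] Γ) := by
  classical
  have hcard : Nat.card (Rˣ →* ℂˣ) = Nat.card K * (Nat.card K - 1) := by
    rw [CommGroup.card_monoidHom_of_hasEnoughRootsOfUnity, B.card_units]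
  have hcard' : Nat.card (Kˣ →* ℂˣ) = Nat.card K - 1 := by
    rw [CommGroup.card_monoidHom_of_hasEnoughRootsOfUnity, Nat.card_units]
  have : Finite (Rˣ →* ℂˣ) := Nat.finite_of_card_ne_zero (by
    rw [CommGroup.card_monoidHom_of_hasEnoughRootsOfUnity]
    exact Nat.card_pos.ne')
  have := Fintype.ofFinite (Rˣ →* ℂˣ)
  let F : (Kˣ →* ℂˣ) → (Rˣ →* ℂˣ) := fun ω => ω.comp B.redUnits
  have hF : Function.Injective F := fun ω ω' h => MonoidHom.ext fun y => by
    obtain ⟨u, rfl⟩ := B.redUnits_surjective y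
    exact DFunLike.congr_fun h u
  -- The q-1 characters inflated from `Kˣ` are those trivial on 1 + πK; q(q-1) - (q-1) = (q-1)²
  -- remain.
  have hrange : ∀ ω : Rˣ →* ℂˣ, ω ∉ Set.range F → ω.comp B.oneAddPi ≠ 1 := by
    intro ω hω h
    refine hω ⟨B.redUnits.liftOfSurjective B.redUnits_surjective ⟨ω, fun u hu => ?_⟩,
      MonoidHom.liftOfRightInverse_comp _ _ _ _⟩
    obtain ⟨x, rfl⟩ := (B.redUnits_eq_one_iff u).1 hu
    exact DFunLike.congr_fun h x
  have hfilter : (Finset.univ.filter fun ω => ω ∈ Set.range F).card = Nat.card K - 1 := by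
    rw [← hcard', ← Nat.card_range_of_injective hF, ← Fintype.card_subtype,
      Nat.card_eq_fintype_card]
  have hq : 1 ≤ Nat.card K := Nat.card_pos
  rw [zeta_eq_sum_zetaOn (fun ω => {r : Irr G | HasWeight B.scalars ω r.rep})
    B.exists_hasWeight_scalars,
    Finset.sum_congr rfl (g := fun ω => if ω ∈ Set.range F then
      zeta (Multiplicative ((Fin 2 → K) × (Fin 2 → K)) ⋊[φ] Γ) else
      (zeta (GL (Fin 2) K)).comp (Polynomial.X ^ Nat.card K ^ 2)) fun ω _ => ?_,
    Finset.sum_ite, Finset.sum_const, Finset.sum_const, Finset.filter_not,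
    Finset.card_sdiff_of_subset (Finset.filter_subset _ _), Finset.card_univ,
    ← Nat.card_eq_fintype_card, hcard, hfilter, nsmul_eq_mul, nsmul_eq_mul, Nat.cast_sub
      (Nat.le_mul_of_pos_left _ hq), Nat.cast_mul, Nat.cast_sub hq, Nat.cast_one]
  · ring
  · split_ifs with h
    · obtain ⟨ω', rfl⟩ := h
      exact B.zetaOn_scalars_of_trivial hφ ω'
    · rw [← B.zetaOn_borel (hrange ω h)]
      congr 1
      ext r
      exact (B.hasWeight_borel_iff (hrange ω h) r).symm

end BlockCoordinates

/-! ### Endomorphisms of R ⊕ K² as block matrices. -/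

section BlockMap

variable {O R K : Type*} [CommRing O] [CommRing R] [Field K] [Algebra O R] [Algebra O K]

/-- The endomorphism `(x, y) ↦ (a x + π (b y), x c + D y)` of `R ⊕ K²`. -/
def blockMap (red : R →ₐ[O] K) (pi : K →ₗ[O] R) (a : R) (b c : Fin 2 → K)
    (D : Matrix (Fin 2) (Fin 2) K) : R × (Fin 2 → K) →ₗ[O] R × (Fin 2 → K) where
  toFun x := (a * x.1 + pi (dotProduct b x.2), red x.1 • c + D.mulVec x.2)
  map_add' x y := by
    ext1
    · simp only [Prod.fst_add, Prod.snd_add, mul_add, dotProduct_add, map_add]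
      abel
    · simp only [Prod.fst_add, Prod.snd_add, map_add, add_smul, Matrix.mulVec_add]
      abel
  map_smul' o x := by
    ext1
    · simp only [Prod.smul_fst, Prod.smul_snd, mul_smul_comm, dotProduct_smul, map_smul,
        RingHom.id_apply, smul_add]
    · simp only [Prod.smul_fst, Prod.smul_snd, map_smul, smul_assoc, Matrix.mulVec_smul,
        RingHom.id_apply, smul_add]

variable {red : R →ₐ[O] K} {pi : K →ₗ[O] R}

theorem blockMap_apply (a : R) (b c : Fin 2 → K) (D : Matrix (Fin 2) (Fin 2) K)
    (x : R) (y : Fin 2 → K) : blockMap red pi a b c D (x, y) =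
      (a * x + pi (dotProduct b y), red x • c + D.mulVec y) := rfl

theorem blockMap_inj (hpi : Function.Injective pi) {a a' : R} {b b' c c' : Fin 2 → K}
    {D D' : Matrix (Fin 2) (Fin 2) K}
    (h : blockMap red pi a b c D = blockMap red pi a' b' c' D') :
    a = a' ∧ b = b' ∧ c = c' ∧ D = D' := by
  have h1 := LinearMap.congr_fun h (1, 0)
  have h2 := fun j => LinearMap.congr_fun h (0, Pi.single j 1)
  simp only [blockMap_apply, mul_one, dotProduct_zero, map_zero, add_zero, map_one, one_smul,
    Matrix.mulVec_zero, Prod.mk.injEq, mul_zero, zero_add, zero_smul, dotProduct_single_one,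
    Matrix.mulVec_single_one] at h1 h2
  exact ⟨h1.1, funext fun j => hpi (h2 j).1, h1.2,
    Matrix.ext fun i j => congrFun (h2 j).2 i⟩

theorem blockMap_comp (hmul : ∀ x y, pi (red x * y) = x * pi y) (hred : ∀ y, red (pi y) = 0)
    (a a' : R) (b b' c c' : Fin 2 → K) (D D' : Matrix (Fin 2) (Fin 2) K) :
    blockMap red pi a b c D ∘ₗ blockMap red pi a' b' c' D' =
      blockMap red pi (a * a' + pi (dotProduct b c')) (red a • b' + Matrix.vecMul b D')
        (red a' • c + D.mulVec c') (D * D') := by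
  refine LinearMap.ext fun ⟨x, y⟩ => ?_
  rw [LinearMap.comp_apply, blockMap_apply, blockMap_apply, blockMap_apply]
  ext1
  · simp only [dotProduct_add, dotProduct_smul, smul_eq_mul, map_add, add_dotProduct,
      smul_dotProduct, hmul, Matrix.dotProduct_mulVec]
    ring
  · simp only [map_add, map_mul, hred, add_zero, Matrix.mulVec_add, Matrix.mulVec_smul, smul_add,
      smul_smul, Matrix.mulVec_mulVec, mul_comm (red x)]
    abel

/-- The element `o` kills K², so the component K² → R lands in the annihilator of `o`, which lies in
ker `red` = im `pi`. The rest is determined on generators, as R and K are quotients of O. -/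
theorem exists_eq_blockMap (hO : Function.Surjective (algebraMap O R))
    (hred : Function.Surjective red) (hpi : ∀ x, red x = 0 → ∃ y, pi y = x)
    {o : O} (ho : algebraMap O K o = 0) (hann : ∀ x : R, o • x = 0 → red x = 0)
    (f : R × (Fin 2 → K) →ₗ[O] R × (Fin 2 → K)) :
    ∃ a b c D, f = blockMap red pi a b c D := by
  have hb : ∀ j, ∃ y, pi y = (f (0, Pi.single j 1)).1 := fun j => hpi _ <| hann _ <| by
    rw [← Prod.smul_fst, ← map_smul, Prod.smul_mk, smul_zero, ← algebraMap_smul K o, ho, zero_smul]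
    exact congrArg Prod.fst (map_zero f)
  choose b hb using hb
  refine ⟨(f (1, 0)).1, b, (f (1, 0)).2, Matrix.of fun i j => (f (0, Pi.single j 1)).2 i, ?_⟩
  refine LinearMap.ext fun ⟨x, y⟩ => ?_
  obtain ⟨s, rfl⟩ := hO x
  have hK : ∀ z : K, ∃ t, algebraMap O K t = z := fun z => by
    obtain ⟨x, rfl⟩ := hred z
    obtain ⟨t, rfl⟩ := hO x
    exact ⟨t, (red.commutes t).symm⟩
  choose t ht using fun j => hK (y j)
  have hy : ((algebraMap O R s, y) : R × (Fin 2 → K)) =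
      s • (1, 0) + (t 0 • (0, Pi.single 0 1) + t 1 • (0, Pi.single 1 1)) := by
    ext1
    · simp [Algebra.algebraMap_eq_smul_one]
    · ext i
      fin_cases i <;> simp [← ht, Algebra.algebraMap_eq_smul_one]
  rw [blockMap_apply, hy, map_add, map_add, map_smul, map_smul, map_smul]
  ext1
  · simp [dotProduct, Fin.sum_univ_two, ← ht, ← hb, Algebra.algebraMap_eq_smul_one]
  · ext i
    fin_cases i <;> simp [← ht, Algebra.algebraMap_eq_smul_one]

theorem blockMap_bijective [Finite R] [Finite K]
    (hred : ∀ y, red (pi y) = 0) (u : Rˣ) (b c : Fin 2 → K) (E : GL (Fin 2) K) :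
    Function.Bijective (blockMap red pi (u : R) b c E.1) := by
  refine Finite.injective_iff_bijective.1 ((injective_iff_map_eq_zero _).2 fun ⟨x, y⟩ h => ?_)
  rw [blockMap_apply, Prod.mk_eq_zero] at h
  have hx : red x = 0 := by
    have := congrArg red h.1
    rw [map_add, hred, add_zero, map_mul, map_zero] at this
    exact (mul_eq_zero.1 this).resolve_left (u.isUnit.map red).ne_zero
  have hy : y = 0 := by
    have := h.2
    rw [hx, zero_smul, zero_add] at this
    rw [← Matrix.one_mulVec y, ← Units.inv_mul E, ← Matrix.mulVec_mulVec, this, Matrix.mulVec_zero]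
  subst hy
  have := h.1
  rw [dotProduct_zero, map_zero, add_zero] at this
  rw [(Units.mul_right_eq_zero u).1 this]
  rfl

/-- Block coordinates on the automorphism group of `R ⊕ K²`. -/
def blockCoordinates [Finite R] [Finite K] (hO : Function.Surjective (algebraMap O R))
    (hred : Function.Surjective red) (hinj : Function.Injective pi)
    (hmul : ∀ x y, pi (red x * y) = x * pi y) (hpi : ∀ x, red x = 0 ↔ ∃ y, pi y = x)
    {o : O} (ho : algebraMap O K o = 0) (hann : ∀ x : R, o • x = 0 → red x = 0) :
    BlockCoordinates ((R × (Fin 2 → K)) ≃ₗ[O] (R × (Fin 2 → K))) R K := by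
  have h0 : ∀ y, red (pi y) = 0 := fun y => (hpi _).2 ⟨y, rfl⟩
  choose a b c D h using exists_eq_blockMap hO hred (fun x => (hpi x).1) ho hann
  -- Uniqueness of coordinates, applied to the two block forms of a composite, yields all four
  -- product rules.
  have hgh := fun g h' : (R × (Fin 2 → K)) ≃ₗ[O] (R × (Fin 2 → K)) =>
    blockMap_inj hinj ((h (g * h').toLinearMap).symm.trans
      ((congrArg₂ (· ∘ₗ ·) (h g.toLinearMap) (h h'.toLinearMap)).trans
        (blockMap_comp hmul h0 _ _ _ _ _ _ _ _)))
  exact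
    { red := red
      red_surjective := hred
      pi := pi
      pi_injective := hinj
      pi_red_mul := hmul
      red_eq_zero_iff := hpi
      a := fun g => a g
      b := fun g => b g
      c := fun g => c g
      D := fun g => D g
      a_mul := fun g k => (hgh g k).1
      b_mul := fun g k => (hgh g k).2.1
      c_mul := fun g k => (hgh g k).2.2.1
      D_mul := fun g k => (hgh g k).2.2.2
      ext := fun g k h1 h2 h3 h4 => LinearEquiv.toLinearMap_injective (by
        rw [h g.toLinearMap, h k.toLinearMap, h1, h2, h3, h4])
      exists_eq := fun u v w E =>
        ⟨LinearEquiv.ofBijective _ (blockMap_bijective h0 u v w E),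
          blockMap_inj hinj (h _).symm⟩ }

end BlockMap

/-! ### The modules O₁ and O₂ of a discrete valuation ring. -/

section Quotients

variable (O : Type*) [CommRing O] [IsLocalRing O]

/-- `M_{(2,1,1)}` is `O₂ ⊕ O₁²`. -/
def equivProd : M O lam211 ≃ₗ[O] Quo O 2 × (Fin 2 → Quo O 1) where
  toFun f := (f 0, fun i => if i = 0 then f 1 else f 2)
  invFun x := Fin.cons x.1 (Fin.cons (x.2 0) (Fin.cons (x.2 1) finZeroElim))
  map_add' f g := by
    ext1
    · rfl
    · ext i; fin_cases i <;> rfl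
  map_smul' o g := by
    ext1
    · rfl
    · ext i; fin_cases i <;> rfl
  left_inv f := by
    ext i; fin_cases i <;> rfl
  right_inv x := by
    ext1
    · rfl
    · ext i; fin_cases i <;> rfl

/-- Conjugation by a linear equivalence. -/
def autCongr {M N : Type*} [AddCommGroup M] [AddCommGroup N] [Module O M] [Module O N]
    (e : M ≃ₗ[O] N) : (M ≃ₗ[O] M) ≃* (N ≃ₗ[O] N) where
  toFun g := (e.symm.trans g).trans e
  invFun g := (e.trans g).trans e.symm
  left_inv g := by ext; simp
  right_inv g := by ext; simp
  map_mul' g h := by ext; simp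

theorem matG11_bijective : Function.Bijective (matG11 O) := by
  constructor
  · intro g h hgh
    ext1 w
    rw [← matG11_mulVec, ← matG11_mulVec, hgh]
  · intro E
    let g : AutM O lam11 := ((Matrix.GeneralLinearGroup.toLin E).toLinearEquiv).restrictScalars O
    refine ⟨g, Units.ext (Matrix.mulVec_injective (funext fun w => ?_))⟩
    rw [matG11_mulVec]
    rfl

/-- `G_{(1,1)}` is `GL₂(O₁)`. -/
def equivGL : AutM O lam11 ≃* GL (Fin 2) (Quo O 1) :=
  MulEquiv.ofBijective (matG11 O) (matG11_bijective O)

instance : (IsLocalRing.maximalIdeal O ^ 1).IsMaximal := by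
  rw [pow_one]
  infer_instance

theorem card_quo_one : Nat.card (Quo O 1) = Nat.card (IsLocalRing.ResidueField O) :=
  Nat.card_congr (Ideal.quotEquivOfEq (pow_one _)).toEquiv

variable {O}

/-- Multiplication by an element of the maximal ideal, as a map `O₁ → O₂`. -/
def mulMap {p : O} (hp : p ∈ IsLocalRing.maximalIdeal O) : Quo O 1 →ₗ[O] Quo O 2 :=
  Submodule.mapQ _ _ (LinearMap.mulLeft O p) fun x hx => by
    rw [Submodule.mem_comap, LinearMap.mulLeft_apply, pow_two]
    exact Ideal.mul_mem_mul hp (by rwa [pow_one] at hx)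

theorem mulMap_mk {p : O} (hp : p ∈ IsLocalRing.maximalIdeal O) (x : O) :
    mulMap hp (Ideal.Quotient.mk _ x) = Ideal.Quotient.mk _ (p * x) := rfl

/-- Reduction `O₂ → O₁`. -/
def redMap : Quo O 2 →ₐ[O] Quo O 1 :=
  Ideal.Quotient.factorₐ O (Ideal.pow_le_pow_right one_le_two)

theorem redMap_mk (x : O) : redMap (Ideal.Quotient.mk _ x) = Ideal.Quotient.mk _ x := rfl

end Quotients

/-- A uniformizer `p` serves both as the map O₁ → O₂, x ↦ px, and as the annihilating element. All
conditions become divisibility by `p` or `p * p` in O, whatever the characteristic. -/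
theorem exists_blockCoordinates (O : Type*) [CommRing O] [IsDomain O] [IsDiscreteValuationRing O]
    [Finite (Quo O 1)] [Finite (Quo O 2)] :
    letI := Ideal.Quotient.field (IsLocalRing.maximalIdeal O ^ 1)
    Nonempty (BlockCoordinates ((Quo O 2 × (Fin 2 → Quo O 1)) ≃ₗ[O] (Quo O 2 × (Fin 2 → Quo O 1)))
      (Quo O 2) (Quo O 1)) := by
  let := Ideal.Quotient.field (IsLocalRing.maximalIdeal O ^ 1)
  obtain ⟨p, hp⟩ := IsDiscreteValuationRing.exists_irreducible O
  have hm := hp.maximalIdeal_eq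
  have hpm : p ∈ IsLocalRing.maximalIdeal O := hm ▸ Ideal.mem_span_singleton_self p
  have hm1 : ∀ x, (Ideal.Quotient.mk (IsLocalRing.maximalIdeal O ^ 1) x = 0) ↔ p ∣ x := fun x => by
    rw [Ideal.Quotient.eq_zero_iff_mem, hm, pow_one, Ideal.mem_span_singleton]
  have hm2 : ∀ x, (Ideal.Quotient.mk (IsLocalRing.maximalIdeal O ^ 2) x = 0) ↔ p * p ∣ x :=
    fun x => by
      rw [Ideal.Quotient.eq_zero_iff_mem, hm, Ideal.span_singleton_pow, Ideal.mem_span_singleton,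
        pow_two]
  refine ⟨blockCoordinates (red := redMap) (pi := mulMap hpm) (o := p)
    Ideal.Quotient.mk_surjective ?_ ?_ ?_ ?_ ((hm1 p).2 dvd_rfl) ?_⟩
  · intro x
    obtain ⟨x, rfl⟩ := Ideal.Quotient.mk_surjective x
    exact ⟨_, redMap_mk x⟩
  · refine (injective_iff_map_eq_zero _).2 fun x hx => ?_
    obtain ⟨x, rfl⟩ := Ideal.Quotient.mk_surjective x
    rw [mulMap_mk, hm2, mul_dvd_mul_iff_left hp.ne_zero] at hx
    exact (hm1 x).2 hx
  · intro x y
    obtain ⟨x, rfl⟩ := Ideal.Quotient.mk_surjective x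
    obtain ⟨y, rfl⟩ := Ideal.Quotient.mk_surjective y
    rw [redMap_mk, mulMap_mk]
    refine (mulMap_mk hpm (x * y)).trans ?_
    rw [mul_left_comm, map_mul]
  · intro x
    obtain ⟨x, rfl⟩ := Ideal.Quotient.mk_surjective x
    refine ((hm1 x).trans ⟨?_, ?_⟩ :)
    · rintro ⟨y, rfl⟩
      exact ⟨_, mulMap_mk hpm y⟩
    · rintro ⟨y, hy⟩
      obtain ⟨y, rfl⟩ := Ideal.Quotient.mk_surjective y
      rw [mulMap_mk, ← sub_eq_zero, ← map_sub, hm2] at hy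
      exact (dvd_sub_right (dvd_mul_right p y)).1 ((dvd_mul_right p p).trans hy)
  · intro x hx
    obtain ⟨x, rfl⟩ := Ideal.Quotient.mk_surjective x
    refine (hm1 x).2 ?_
    have : Ideal.Quotient.mk (IsLocalRing.maximalIdeal O ^ 2) (p * x) = 0 := hx
    rwa [hm2, mul_dvd_mul_iff_left hp.ne_zero] at this

end RepZeta

end

/-! ### The theorem for a local field. -/

theorem lemma6p6 (F : Type*) [Field F] [ValuativeRel F] [TopologicalSpace F]
    [IsNonarchimedeanLocalField F] (q : ℕ) (hq : q = Nat.card 𝓀[F]) :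
    Finite (RepZeta.Irr (RepZeta.AutM 𝒪[F] RepZeta.lam211)) ∧
    Finite (RepZeta.Irr (RepZeta.SemiG11 𝒪[F])) ∧
    Finite (RepZeta.Irr (RepZeta.AutM 𝒪[F] RepZeta.lam11)) ∧
    Finite (RepZeta.Irr (GL (Fin 2) (RepZeta.Quo 𝒪[F] 1))) ∧
    RepZeta.zeta (RepZeta.AutM 𝒪[F] RepZeta.lam211) =
      ((q : ℤ[X]) - 1) ^ 2 *
          (RepZeta.zeta (GL (Fin 2) (RepZeta.Quo 𝒪[F] 1))).comp (Polynomial.X ^ q ^ 2) +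
        ((q : ℤ[X]) - 1) * RepZeta.zeta (RepZeta.SemiG11 𝒪[F]) ∧
    RepZeta.zeta (RepZeta.SemiG11 𝒪[F]) =
      RepZeta.zeta (RepZeta.AutM 𝒪[F] RepZeta.lam11) +
        2 * ((q : ℤ[X]) - 1) * Polynomial.X ^ (q ^ 2 - 1) +
        ((q : ℤ[X]) - 1) ^ 2 * Polynomial.X ^ ((q ^ 2 - 1) * q) +
        ((q : ℤ[X]) + 2) * Polynomial.X ^ ((q ^ 2 - 1) * (q - 1)) := by
  open RepZeta in
  have hq1 : q = Nat.card (Quo 𝒪[F] 1) := hq.trans (card_quo_one 𝒪[F]).symm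
  have : Finite (Quo 𝒪[F] 1) := by
    have : Finite (𝒪[F] ⧸ IsLocalRing.maximalIdeal 𝒪[F]) := inferInstanceAs (Finite 𝓀[F])
    exact Finite.of_equiv _
      (Ideal.quotEquivOfEq (pow_one (IsLocalRing.maximalIdeal 𝒪[F]))).symm.toEquiv
  have : Finite (Quo 𝒪[F] 2) := by
    have : Finite (𝒪[F] ⧸ IsLocalRing.maximalIdeal 𝒪[F]) := inferInstanceAs (Finite 𝓀[F])
    exact Ideal.finite_quotient_pow (IsNoetherian.noetherian (IsLocalRing.maximalIdeal 𝒪[F])) 2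
  have : Finite (AutM 𝒪[F] lam11) := Finite.of_equiv _ (equivGL 𝒪[F]).symm.toEquiv
  have : Finite ((Quo 𝒪[F] 2 × (Fin 2 → Quo 𝒪[F] 1)) ≃ₗ[𝒪[F]]
    (Quo 𝒪[F] 2 × (Fin 2 → Quo 𝒪[F] 1))) := DFunLike.finite _
  have : Finite (AutM 𝒪[F] lam211) :=
    Finite.of_equiv _ (autCongr 𝒪[F] (equivProd 𝒪[F])).symm.toEquiv
  refine ⟨inferInstance, inferInstance, inferInstance, inferInstance, ?_, ?_⟩
  · obtain ⟨B⟩ := exists_blockCoordinates 𝒪[F]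
    rw [zeta_congr (autCongr 𝒪[F] (equivProd 𝒪[F])), hq1]
    let := Ideal.Quotient.field (IsLocalRing.maximalIdeal 𝒪[F] ^ 1)
    -- The compatibility is definitional: `vwAction` is `vwEquiv` at the matrix given by `equivGL`.
    exact B.zeta_eq (m := equivGL 𝒪[F]) (φ := vwAction 𝒪[F]) fun _ _ => rfl
  · rw [hq1]
    let := Ideal.Quotient.field (IsLocalRing.maximalIdeal 𝒪[F] ^ 1)
    exact zeta_vw (m := equivGL 𝒪[F]) (φ := vwAction 𝒪[F]) fun _ _ => rfl
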